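/- Let $F\in\mathbb Z[X]$ be irreducible over $\mathbb Q$ (for example, non-constant and irreducible in $\mathbb Z[X]$; $F$ need not be primitive). Let $\theta$ be a root of $F$ and let $K_F=\mathbb Q(\theta)$, with Dedekind zeta function $\zeta_{K_F}$. For $n\geq 1$ put $$\varrho_F(n)=\#\{0\leq k\leq n-1: F(k)\equiv 0 \bmod n\},\qquad D_F(s)=\sum_{n\geq 1}\frac{\varrho_F(n)}{n^s}.$$ Then $D_F(s)$ converges absolutely for $\operatorname{Re} s>1$, and there is a holomorphic function $\Psi$ on $\operatorname{Re} s>\frac12$, bounded on $\operatorname{Re} s>\frac12+\varepsilon$ for every $\varepsilon>0$ (with a bound that may depend on $\varepsilon$), such that $$D_F(s)=\zeta_{K_F}(s)\Psi(s)\qquad(\operatorname{Re} s>1).$$ The function $\zeta_{K_F}$ continues meromorphically to $\operatorname{Re} s>\eta$ for some $\eta\in[\frac12,1)$. For every $\eta\in[\frac12,1)$ and every meromorphic continuation of $\zeta_{K_F}$ to $\operatorname{Re} s>\eta$, the product $\zeta_{K_F}\Psi$ is a meromorphic continuation of $D_F$ to $\operatorname{Re} s>\eta$, and it has a simple pole at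 $s=1$. Moreover, there are $\lambda\in(0,1)$ and $C$ (depending on $F$) such that for all real $X\geq 1$ $$\Bigl|\sum_{1\leq n\leq X}\varrho_F(n)-Z_F X\Bigr|\leq C X^{\lambda},\qquad Z_F=\Psi(1)\lim_{s\to 1}(s-1)\zeta_{K_F}(s),$$ where the limit is that of the continued zeta function, i.e. its residue at $s=1$, which equals the value given by the analytic class number formula. -/

import Mathlib

/-- `polyRho F n = #{0 ≤ k ≤ n - 1 : F(k) ≡ 0 mod n}`. -/
def polyRho (F : Polynomial ℤ) (n : ℕ) : ℕ :=
  ((Finset.range n).filter fun k : ℕ => (n : ℤ) ∣ F.eval (k : ℤ)).card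

/-- The Dirichlet series `∑_{n ≥ 1} polyRho F n / n ^ s`. -/
noncomputable def polyRhoSeries (F : Polynomial ℤ) (s : ℂ) : ℂ :=
  LSeries (fun n : ℕ => (polyRho F n : ℂ)) s

/-- `g` is a meromorphic continuation to the half-plane `Re s > η` of the function `f`
given on `Re s > 1`. For `η ≤ 1` such a `g` is unique up to its values on a discrete set. -/
def IsMeromorphicContinuation (f g : ℂ → ℂ) (η : ℝ) : Prop :=
  MeromorphicOn g {s : ℂ | η < s.re} ∧ ∀ s : ℂ, 1 < s.re → g s = f s

/-! Write `K` for the field generated by the root and `d` for its degree. `Ψ` is the Dirichlet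
series of `g = polyRhoQuotient F K`, the convolution of `polyRho F` with the inverse `idealMoebius
K` of the ideal counting function, so the factorisation is the identity `g * idealCount K =
polyRhoFunction F`. Everything then rests on the size of `g` and on the distribution of ideal norms.

The function `g` is multiplicative. Away from finitely many primes, roots of `F` modulo `p`
correspond to ring homomorphisms `𝓞 K →+* ZMod p`, hence to ideals of norm `p`
(`exists_finite_polyRho_eq_card_ideal`), and so `g p = 0`. A Bézout identity `U * F + V * F' = D`
with `D ≠ 0` bounds the number of roots modulo `p ^ k` independently of `k`
(`polyRho_prime_pow_le`), whence `g (p ^ k) = O(k + 1)`, uniformly outside a finite set of primes.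
The series of `g` is therefore dominated by a sum of `p ^ (-2σ)` and converges absolutely for `σ >
1/2`. At `s = 1` each local factor is nonzero, and so is the Euler product; this makes the pole at
`1` simple.

The analytic input is the ideal count `κ X + O(X ^ (1 - 1/(2d)))`. It comes from lattice points in
dilates of `normLeOne K`: the points that a displacement of length `ε` can carry across the boundary
have measure `O(√ε)` (`volume_boundary_normLeOne_le`). This weak bound avoids parametrising the
boundary and still saves a power. Partial summation turns the count into a continuation of zeta, and
convolution with `g` turns it into the mean value of `polyRho F`. -/

section

/-! ### Volumes of thin sets in the mixed space. -/

open NumberField NumberField.InfinitePlace NumberField.mixedEmbedding MeasureTheory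
open scoped Classical

namespace NumberField.mixedEmbedding

variable {K : Type*} [Field K]

/-- The real-linear map of the mixed space that multiplies the coordinate at `w` by `c w`. -/
noncomputable def placeScaling (c : InfinitePlace K → ℝ) : mixedSpace K →ₗ[ℝ] mixedSpace K :=
  LinearMap.prodMap
    (LinearMap.pi fun w : {w : InfinitePlace K // IsReal w} ↦
      (c w • LinearMap.id : ℝ →ₗ[ℝ] ℝ).comp (LinearMap.proj w))
    (LinearMap.pi fun w : {w : InfinitePlace K // IsComplex w} ↦
      (c w • LinearMap.id : ℂ →ₗ[ℝ] ℂ).comp (LinearMap.proj w))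

theorem normAtPlace_placeScaling (c : InfinitePlace K → ℝ) (w : InfinitePlace K)
    (x : mixedSpace K) : normAtPlace w (placeScaling c x) = |c w| * normAtPlace w x := by
  obtain hw | hw := isReal_or_isComplex w
  · simp [normAtPlace_apply_of_isReal hw, placeScaling]
  · simp [normAtPlace_apply_of_isComplex hw, placeScaling]

/-- Stretching the coordinate at one place by a factor `r ≥ 1`. -/
noncomputable def stretch (w : InfinitePlace K) (r : ℝ) : mixedSpace K →ₗ[ℝ] mixedSpace K :=
  placeScaling (Function.update 1 w r)

theorem normAtPlace_stretch_self {w : InfinitePlace K} {r : ℝ} (hr : 0 ≤ r) (x : mixedSpace K) :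
    normAtPlace w (stretch w r x) = r * normAtPlace w x := by
  simp [stretch, normAtPlace_placeScaling, abs_of_nonneg hr]

theorem normAtPlace_stretch_of_ne {v w : InfinitePlace K} (h : v ≠ w) (r : ℝ) (x : mixedSpace K) :
    normAtPlace v (stretch w r x) = normAtPlace v x := by
  simp [stretch, normAtPlace_placeScaling, Function.update_of_ne h]

/-- The vector of logarithms of the absolute values at all places. -/
noncomputable def logNorms (x : mixedSpace K) : InfinitePlace K → ℝ :=
  fun w ↦ Real.log (normAtPlace w x)

theorem logNorms_stretch {w : InfinitePlace K} {r : ℝ} (hr : 0 < r) {x : mixedSpace K}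
    (hx : normAtPlace w x ≠ 0) :
    logNorms (stretch w r x) = logNorms x + Pi.single w (Real.log r) := by
  ext v
  by_cases hv : v = w
  · subst hv
    simp [logNorms, normAtPlace_stretch_self hr.le, Real.log_mul hr.ne' hx, add_comm]
  · simp [logNorms, normAtPlace_stretch_of_ne hv, hv]

variable [NumberField K]

theorem det_placeScaling (c : InfinitePlace K → ℝ) :
    LinearMap.det (placeScaling c) = ∏ w, c w ^ mult w := by
  rw [placeScaling, LinearMap.det_prodMap, LinearMap.det_pi, LinearMap.det_pi,
    prod_eq_prod_mul_prod]
  simp [LinearMap.det_smul, Complex.finrank_real_complex, mult_isReal, mult_isComplex]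

theorem norm_le_iff_normAtPlace_le {x : mixedSpace K} {M : ℝ} :
    ‖x‖ ≤ M ↔ ∀ w, normAtPlace w x ≤ M := by
  rw [norm_eq_sup'_normAtPlace, Finset.sup'_le_iff]
  simp

theorem det_stretch (w : InfinitePlace K) (r : ℝ) :
    LinearMap.det (stretch w r) = r ^ mult w := by
  rw [stretch, det_placeScaling, Finset.prod_eq_single w]
  · simp
  · intro v _ hv
    simp [Function.update_of_ne hv]
  · simp

/-- The determinant is `r` or `r ^ 2`, according to the type of the place. Keeping only one power of
`r` treats both types alike and suffices for bounds linear in the thickness. -/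
theorem volume_preimage_stretch_ge (w : InfinitePlace K) {r : ℝ} (hr : 0 < r) (hr1 : r ≤ 1)
    (s : Set (mixedSpace K)) :
    ENNReal.ofReal r⁻¹ * volume s ≤ volume (stretch w r ⁻¹' s) := by
  have hdet : LinearMap.det (stretch w r) ≠ 0 := by
    rw [det_stretch]; positivity
  rw [Measure.addHaar_preimage_linearMap _ hdet, det_stretch]
  gcongr
  rw [abs_of_pos (by positivity)]
  exact inv_anti₀ (by positivity) (pow_le_of_le_one hr.le hr1 mult_ne_zero)

/-- The points of a ball close to a coordinate hyperplane. -/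
theorem volume_normAtPlace_le (w : InfinitePlace K) (M : ℝ) :
    ∃ C : ℝ, 0 ≤ C ∧ ∀ η : ℝ, 0 < η →
      volume {x : mixedSpace K | ‖x‖ ≤ M ∧ normAtPlace w x ≤ η} ≤ ENNReal.ofReal (C * η) := by
  have hfin : volume (Metric.closedBall (0 : mixedSpace K) (max M 1)) ≠ ⊤ :=
    measure_closedBall_lt_top.ne
  refine ⟨(volume (Metric.closedBall (0 : mixedSpace K) (max M 1))).toReal,
    ENNReal.toReal_nonneg, fun η hη ↦ ?_⟩
  rw [ENNReal.ofReal_mul ENNReal.toReal_nonneg, ENNReal.ofReal_toReal hfin]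
  set E := {x : mixedSpace K | ‖x‖ ≤ M ∧ normAtPlace w x ≤ η}
  rcases le_total 1 η with h1 | h1
  · refine (measure_mono (fun x hx ↦ ?_)).trans (le_mul_of_one_le_right' ?_)
    · simpa using Or.inl hx.1
    · simpa using h1
  -- The preimage expands the thin direction by `η⁻¹` but stays in a fixed ball, so `η⁻¹ * volume E`
  -- is bounded.
  have hsub : stretch w η ⁻¹' E ⊆ Metric.closedBall (0 : mixedSpace K) (max M 1) := by
    rintro x ⟨hx1, hx2⟩
    rw [mem_closedBall_zero_iff, norm_le_iff_normAtPlace_le]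
    intro v
    by_cases hv : v = w
    · subst hv
      rw [normAtPlace_stretch_self hη.le] at hx2
      exact le_max_of_le_right (le_of_mul_le_mul_left (by simpa using hx2) hη)
    · have := norm_le_iff_normAtPlace_le.mp hx1 v
      rw [normAtPlace_stretch_of_ne hv] at this
      exact le_max_of_le_left this
  have h := (volume_preimage_stretch_ge w hη h1 E).trans (measure_mono hsub)
  rw [ENNReal.ofReal_inv_of_pos hη, mul_comm, ← div_eq_mul_inv] at h
  exact (ENNReal.div_le_iff (by simpa using hη) (by simp)).mp h

theorem measurable_logNorms : Measurable (logNorms : mixedSpace K → InfinitePlace K → ℝ) :=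
  measurable_pi_iff.mpr fun w ↦ Real.measurable_log.comp (continuous_normAtPlace w).measurable

/-- The points of a ball whose logarithms lie in a thin slab. -/
theorem volume_logNorms_slab_le (Λ : (InfinitePlace K → ℝ) →ₗ[ℝ] ℝ) (hΛ : Λ ≠ 0) (c M : ℝ) :
    ∃ C : ℝ, 0 ≤ C ∧ ∀ η : ℝ, 0 < η →
      volume {x : mixedSpace K | ‖x‖ ≤ M ∧ (∀ w, 0 < normAtPlace w x) ∧
        |Λ (logNorms x) - c| ≤ η} ≤ ENNReal.ofReal (C * η) := by
  -- Choose a place on which `Λ` really depends: rescaling that coordinate translates the slab.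
  obtain ⟨w, hw⟩ : ∃ w, Λ (Pi.single w 1) ≠ 0 := by
    by_contra! h
    exact hΛ (LinearMap.pi_ext' fun w ↦ LinearMap.ext_ring (by simpa using h w))
  set β := Λ (Pi.single w 1) with hβ
  -- The translates used below have `k ≤ η⁻¹`, so they expand by at most `exp (3 / |β|)`.
  set R := max M 0 * Real.exp (3 / |β|) with hR
  have hfin : volume (Metric.closedBall (0 : mixedSpace K) R) ≠ ⊤ :=
    measure_closedBall_lt_top.ne
  refine ⟨(volume (Metric.closedBall (0 : mixedSpace K) R)).toReal,
    ENNReal.toReal_nonneg, fun η hη ↦ ?_⟩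
  rw [ENNReal.ofReal_mul ENNReal.toReal_nonneg, ENNReal.ofReal_toReal hfin]
  set E := {x : mixedSpace K | ‖x‖ ≤ M ∧ (∀ w, 0 < normAtPlace w x) ∧
        |Λ (logNorms x) - c| ≤ η} with hE
  have hβ0 : 0 < |β| := abs_pos.mpr hw
  have hEm : MeasurableSet E := by
    have : E = {x | ‖x‖ ≤ M} ∩ ((⋂ w, {x | 0 < normAtPlace w x}) ∩
        {x | |Λ (logNorms x) - c| ≤ η}) := by
      ext x; simp [hE]
    rw [this]
    refine (measurableSet_le measurable_norm measurable_const).inter (.inter ?_ ?_)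
    · exact .iInter fun w ↦ measurableSet_lt measurable_const (continuous_normAtPlace w).measurable
    · exact measurableSet_le (((Λ.continuous_of_finiteDimensional.measurable.comp
        measurable_logNorms).sub_const c).abs) measurable_const
  -- the scaling factors
  let r : ℕ → ℝ := fun k ↦ Real.exp (-(3 * η * k / |β|))
  have hr : ∀ k, 0 < r k := fun k ↦ Real.exp_pos _
  have hr1 : ∀ k, r k ≤ 1 := fun k ↦ Real.exp_le_one_iff.mpr (by
    rw [neg_nonpos]; positivity)
  set N := ⌊η⁻¹⌋₊ with hN
  have hpos : ∀ k x, x ∈ stretch w (r k) ⁻¹' E → 0 < normAtPlace w x := by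
    intro k x hx
    have := hx.2.1 w
    rw [normAtPlace_stretch_self (hr k).le] at this
    exact pos_of_mul_pos_right this (hr k).le
  -- The `k`-th rescaling shifts the value of `Λ` by `± 3ηk`, while the slab has width `2η`. More
  -- than `η⁻¹` disjoint copies, each at least as large as `E`, thus fit into one ball.
  have hdisj : Set.PairwiseDisjoint (↑(Finset.range (N + 1)))
      (fun k ↦ stretch w (r k) ⁻¹' E) := by
    intro i _ j _ hij
    refine Set.disjoint_left.mpr fun x hi hj ↦ ?_
    have hx := (hpos i x hi).ne'
    have key : ∀ k, Λ (logNorms (stretch w (r k) x)) =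
        Λ (logNorms x) - 3 * η * k / |β| * β := by
      intro k
      rw [logNorms_stretch (hr k) hx, Real.log_exp, map_add, hβ,
        show (Pi.single w (-(3 * η * k / |Λ (Pi.single w 1)|)) : InfinitePlace K → ℝ) =
          (-(3 * η * k / |Λ (Pi.single w 1)|)) • Pi.single w (1 : ℝ) by
          rw [← Pi.single_smul]; simp, map_smul]
      simp; ring
    have h1 := hi.2.2
    have h2 := hj.2.2
    rw [key] at h1 h2
    have h3 : |(3 * η * j / |β| * β) - 3 * η * i / |β| * β| ≤ 2 * η := by
      rw [abs_le] at *
      constructor <;> linarith [h1.1, h1.2, h2.1, h2.2]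
    have h4 : (3 * η * j / |β| * β) - 3 * η * i / |β| * β = 3 * η * ((j : ℝ) - i) * (β / |β|) := by
      field_simp
    rw [h4, abs_mul, abs_mul, abs_div, abs_abs, div_self hβ0.ne', mul_one,
      abs_of_pos (by positivity : (0 : ℝ) < 3 * η)] at h3
    have h5 : (1 : ℝ) ≤ |(j : ℝ) - i| := by
      have : (1 : ℤ) ≤ |(j : ℤ) - i| := Int.one_le_abs (by omega)
      exact_mod_cast this
    nlinarith
  have hsub : ∀ k ∈ Finset.range (N + 1), stretch w (r k) ⁻¹' E ⊆
      Metric.closedBall (0 : mixedSpace K) R := by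
    rintro k hk x hx
    have hk' : 3 * η * k / |β| ≤ 3 / |β| := by
      gcongr
      have : (k : ℝ) ≤ η⁻¹ := (Nat.cast_le.mpr (Nat.lt_succ_iff.mp (Finset.mem_range.mp hk))).trans
        (Nat.floor_le (by positivity))
      calc 3 * η * k ≤ 3 * η * η⁻¹ := by gcongr
        _ = 3 := by field_simp
    rw [mem_closedBall_zero_iff, norm_le_iff_normAtPlace_le]
    intro v
    have h0 := norm_le_iff_normAtPlace_le.mp hx.1 v
    by_cases hv : v = w
    · subst hv
      rw [normAtPlace_stretch_self (hr k).le] at h0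
      calc normAtPlace v x = (r k * normAtPlace v x) * Real.exp (3 * η * k / |β|) := by
            rw [mul_right_comm, ← Real.exp_add]; simp
        _ ≤ max M 0 * Real.exp (3 / |β|) :=
            mul_le_mul (h0.trans (le_max_left _ _)) (Real.exp_le_exp.mpr hk')
              (Real.exp_pos _).le (le_max_right _ _)
    · rw [normAtPlace_stretch_of_ne hv] at h0
      exact (h0.trans (le_max_left _ _)).trans
        (le_mul_of_one_le_right (le_max_right _ _) (Real.one_le_exp (by positivity)))
  have hmeas : ∀ k, MeasurableSet (stretch w (r k) ⁻¹' E) := fun k ↦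
    hEm.preimage (stretch w (r k)).continuous_of_finiteDimensional.measurable
  have hsum : ((N + 1 : ℕ) : ENNReal) * volume E ≤
      volume (Metric.closedBall (0 : mixedSpace K) R) := by
    calc ((N + 1 : ℕ) : ENNReal) * volume E = ∑ k ∈ Finset.range (N + 1), volume E := by simp
      _ ≤ ∑ k ∈ Finset.range (N + 1), volume (stretch w (r k) ⁻¹' E) := by
          refine Finset.sum_le_sum fun k _ ↦ le_trans ?_
            (volume_preimage_stretch_ge w (hr k) (hr1 k) E)
          refine le_mul_of_one_le_left' ?_
          simpa using (one_le_inv₀ (hr k)).mpr (hr1 k)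
      _ = volume (⋃ k ∈ Finset.range (N + 1), stretch w (r k) ⁻¹' E) :=
          (measure_biUnion_finset hdisj fun k _ ↦ hmeas k).symm
      _ ≤ _ := measure_mono (Set.iUnion₂_subset hsub)
  have h1 : ENNReal.ofReal η⁻¹ * volume E ≤ volume (Metric.closedBall (0 : mixedSpace K) R) := by
    refine le_trans ?_ hsum
    gcongr
    rw [← ENNReal.ofReal_natCast]
    exact ENNReal.ofReal_le_ofReal (by push_cast; exact (Nat.lt_floor_add_one _).le)
  rw [ENNReal.ofReal_inv_of_pos hη, mul_comm, ← div_eq_mul_inv] at h1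
  exact (ENNReal.div_le_iff (by simpa using hη) (by simp)).mp h1

end NumberField.mixedEmbedding

end

/-! ### The boundary of `normLeOne K`. -/

section

open NumberField NumberField.InfinitePlace NumberField.mixedEmbedding MeasureTheory
open NumberField.mixedEmbedding.fundamentalCone NumberField.Units.dirichletUnitTheorem
open scoped Classical

namespace NumberField.mixedEmbedding

variable {K : Type*} [Field K] [NumberField K]

/-- The coordinates, in the basis `completeBasis K`, of a vector of logarithms weighted by the
multiplicities of the places. -/
noncomputable def logCoord (w : InfinitePlace K) : (InfinitePlace K → ℝ) →ₗ[ℝ] ℝ :=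
  (completeBasis K).coord w ∘ₗ
    LinearMap.pi fun v : InfinitePlace K ↦ (mult v : ℝ) • LinearMap.proj v

theorem logCoord_apply (w : InfinitePlace K) (l : InfinitePlace K → ℝ) :
    logCoord w l = (completeBasis K).equivFun (fun v ↦ (mult v : ℝ) * l v) w := by
  simp only [logCoord, LinearMap.comp_apply, Module.Basis.coord_apply,
    Module.Basis.equivFun_apply]
  rfl

theorem logCoord_ne_zero (w : InfinitePlace K) : logCoord w ≠ 0 := by
  intro h
  have h1 := LinearMap.congr_fun h (fun v ↦ (mult v : ℝ)⁻¹ * completeBasis K w v)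
  rw [logCoord_apply] at h1
  have : (fun v : InfinitePlace K ↦ (mult v : ℝ) * ((mult v : ℝ)⁻¹ * completeBasis K w v)) =
      completeBasis K w := by
    ext v
    rw [mul_inv_cancel_left₀ mult_coe_ne_zero]
  rw [this] at h1
  simp at h1

theorem mem_normLeOne_iff_logCoord {x : mixedSpace K} :
    x ∈ normLeOne K ↔ (∀ w, 0 < normAtPlace w x) ∧
      ∀ w : InfinitePlace K, logCoord w (logNorms x) ∈
        (if w = w₀ then Set.Iic (0 : ℝ) else Set.Ico 0 1) := by
  rw [normLeOne_eq_preimage, Set.mem_preimage]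
  constructor
  · rintro ⟨y, hy, hyx⟩
    have hpos : ∀ w, 0 < normAtPlace w x := fun w ↦ by
      have := expMapBasis_pos y w
      rwa [hyx] at this
    refine ⟨hpos, fun w ↦ ?_⟩
    have : (fun v ↦ (mult v : ℝ) * logNorms x v) = (completeBasis K).equivFun.symm y := by
      ext v
      have h1 : Real.exp ((mult v : ℝ)⁻¹ * (completeBasis K).equivFun.symm y v) =
        normAtPlace v x := congr_fun hyx v
      rw [logNorms, ← h1, Real.log_exp, mul_inv_cancel_left₀ mult_coe_ne_zero]
    rw [logCoord_apply, this, LinearEquiv.apply_symm_apply]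
    exact hy w (Set.mem_univ _)
  · rintro ⟨hpos, h⟩
    refine ⟨(completeBasis K).equivFun fun v ↦ (mult v : ℝ) * logNorms x v, fun w _ ↦ ?_, ?_⟩
    · simpa only [logCoord_apply] using h w
    · ext w
      rw [expMapBasis_apply, LinearEquiv.symm_apply_apply, expMap_apply,
        inv_mul_cancel_left₀ mult_coe_ne_zero, logNorms, Real.exp_log (hpos w)]

/-- The logarithm has slope at most `1 / η` on `[η, ∞)`, so a displacement of size `η ^ 2` costs at
most `η`. Here the square root in the boundary estimate arises, with `η = √ε`. -/
theorem norm_logNorms_add_sub_le {x u : mixedSpace K} {η : ℝ} (hη : 0 < η) (hη1 : η ≤ 1)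
    (hx : ∀ w, 2 * η < normAtPlace w x) (hu : ‖u‖ ≤ η ^ 2) :
    (∀ w, 0 < normAtPlace w (x + u)) ∧ ‖logNorms (x + u) - logNorms x‖ ≤ η := by
  have key : ∀ w, |normAtPlace w (x + u) - normAtPlace w x| ≤ η ^ 2 ∧
      η ≤ normAtPlace w (x + u) := by
    intro w
    have h1 := normAtPlace_add_le w x u
    have h2 := normAtPlace_add_le w (x + u) (-u)
    rw [add_neg_cancel_right, normAtPlace_neg] at h2
    have h3 := norm_le_iff_normAtPlace_le.mp hu w
    have h4 := hx w
    refine ⟨abs_le.mpr ⟨by linarith, by linarith⟩, by nlinarith⟩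
  refine ⟨fun w ↦ hη.trans_le (key w).2, (pi_norm_le_iff_of_nonneg hη.le).mpr fun w ↦ ?_⟩
  have hlog : ∀ a b : ℝ, η ≤ a → η ≤ b → a - b ≤ η ^ 2 → Real.log a - Real.log b ≤ η := by
    intro a b ha hb hab
    have hb0 : 0 < b := hη.trans_le hb
    rw [← Real.log_div (hη.trans_le ha).ne' hb0.ne']
    refine (Real.log_le_sub_one_of_pos (div_pos (hη.trans_le ha) hb0)).trans ?_
    rw [div_sub_one hb0.ne', div_le_iff₀ hb0]
    nlinarith
  have h := abs_le.mp (key w).1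
  have hxw : η ≤ normAtPlace w x := by linarith [hx w]
  rw [Pi.sub_apply, Real.norm_eq_abs, abs_le]
  have h1 := hlog _ _ (key w).2 hxw (by linarith)
  have h2 := hlog _ _ hxw (key w).2 (by linarith)
  constructor <;> simp only [logNorms] <;> linarith

/-- In the coordinates `logCoord` the set is a box with sides `(-∞, 0]` and `[0, 1)`. If a
displacement of length `ε` changes membership, then the point has a coordinate of size at most
`2√ε`, or some `logCoord` lies within `O(√ε)` of `0` or `1`. Each of these sets has measure `O(√ε)`.
-/
theorem volume_boundary_normLeOne_le :
    ∃ C : ℝ, 0 ≤ C ∧ ∀ ε : ℝ, 0 < ε → ε ≤ 1 →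
      volume {x : mixedSpace K | ∃ u, ‖u‖ ≤ ε ∧ ¬ (x ∈ normLeOne K ↔ x + u ∈ normLeOne K)} ≤
        ENNReal.ofReal (C * √ε) := by
  obtain ⟨M, hM⟩ := isBounded_iff_forall_norm_le.mp (isBounded_normLeOne K)
  choose C₁ hC₁ h₁ using fun w : InfinitePlace K ↦ volume_normAtPlace_le w (M + 1)
  choose C₂ hC₂ h₂ using fun w : InfinitePlace K ↦
    volume_logNorms_slab_le (logCoord w) (logCoord_ne_zero w) 0 (M + 1)
  choose C₃ hC₃ h₃ using fun w : InfinitePlace K ↦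
    volume_logNorms_slab_le (logCoord w) (logCoord_ne_zero w) 1 (M + 1)
  let B : InfinitePlace K → ℝ := fun w ↦ ‖(logCoord w).toContinuousLinearMap‖ + 1
  have hB : ∀ w, 0 < B w := fun w ↦ by positivity
  refine ⟨∑ w, (C₁ w * 2 + (C₂ w * B w + C₃ w * B w)), Finset.sum_nonneg fun w _ ↦ ?_, ?_⟩
  · have := hC₁ w; have := hC₂ w; have := hC₃ w; have := hB w
    positivity
  intro ε hε hε1
  have hη : 0 < √ε := Real.sqrt_pos.mpr hε
  have hη1 : √ε ≤ 1 := Real.sqrt_le_one.mpr hε1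
  have hsub : {x : mixedSpace K | ∃ u, ‖u‖ ≤ ε ∧ ¬ (x ∈ normLeOne K ↔ x + u ∈ normLeOne K)} ⊆
      ⋃ w ∈ (Finset.univ : Finset (InfinitePlace K)),
        ({x : mixedSpace K | ‖x‖ ≤ M + 1 ∧ normAtPlace w x ≤ 2 * √ε} ∪
        ({x : mixedSpace K | ‖x‖ ≤ M + 1 ∧ (∀ w, 0 < normAtPlace w x) ∧
          |logCoord w (logNorms x) - 0| ≤ B w * √ε} ∪
        {x : mixedSpace K | ‖x‖ ≤ M + 1 ∧ (∀ w, 0 < normAtPlace w x) ∧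
          |logCoord w (logNorms x) - 1| ≤ B w * √ε})) := by
    rintro x ⟨u, hu, hne⟩
    have hxM : ‖x‖ ≤ M + 1 := by
      by_cases hx : x ∈ normLeOne K
      · linarith [hM x hx]
      · have hxu : x + u ∈ normLeOne K := by tauto
        have := norm_sub_le (x + u) u
        rw [add_sub_cancel_right] at this
        linarith [hM _ hxu]
    simp only [Finset.mem_univ, Set.iUnion_true, Set.mem_iUnion]
    by_cases hsmall : ∃ w, normAtPlace w x ≤ 2 * √ε
    · obtain ⟨w, hw⟩ := hsmall
      exact ⟨w, Or.inl ⟨hxM, hw⟩⟩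
    push Not at hsmall
    obtain ⟨hpos', hlog⟩ := norm_logNorms_add_sub_le hη hη1 hsmall
      (by rwa [Real.sq_sqrt hε.le])
    have hpos : ∀ w, 0 < normAtPlace w x := fun w ↦ lt_trans (by positivity) (hsmall w)
    have hclose : ∀ w, |logCoord w (logNorms (x + u)) - logCoord w (logNorms x)| ≤
        B w * √ε := by
      intro w
      rw [← map_sub]
      refine ((logCoord w).toContinuousLinearMap.le_opNorm _).trans ?_
      refine mul_le_mul ?_ hlog (norm_nonneg _) (hB w).le
      simp [B]
    rw [mem_normLeOne_iff_logCoord, mem_normLeOne_iff_logCoord] at hne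
    simp only [hpos, hpos', implies_true, true_and] at hne
    obtain ⟨w, hw⟩ : ∃ w : InfinitePlace K, ¬ (logCoord w (logNorms x) ∈
        (if w = w₀ then Set.Iic (0 : ℝ) else Set.Ico 0 1) ↔ logCoord w (logNorms (x + u)) ∈
        (if w = w₀ then Set.Iic (0 : ℝ) else Set.Ico 0 1)) := by
      by_contra! h
      exact hne (forall_congr' h)
    have hc := abs_le.mp (hclose w)
    refine ⟨w, Or.inr ?_⟩
    set a := logCoord w (logNorms x)
    set b := logCoord w (logNorms (x + u))
    have : |a - 0| ≤ B w * √ε ∨ |a - 1| ≤ B w * √ε := by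
      by_contra! hcon
      rw [lt_abs, lt_abs] at hcon
      apply hw
      split_ifs with h
      · simp only [Set.mem_Iic]
        constructor <;> intro _ <;> rcases hcon.1 with h | h <;> linarith
      · simp only [Set.mem_Ico]
        constructor <;> rintro ⟨_, _⟩ <;> rcases hcon.1 with h | h <;>
          rcases hcon.2 with h' | h' <;> constructor <;> linarith
    exact this.imp (fun h ↦ ⟨hxM, hpos, h⟩) (fun h ↦ ⟨hxM, hpos, h⟩)
  clear_value B
  refine (measure_mono hsub).trans ((measure_biUnion_finset_le _ _).trans ?_)
  rw [Finset.sum_mul, ENNReal.ofReal_sum_of_nonneg fun w _ ↦ by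
    have := hC₁ w; have := hC₂ w; have := hC₃ w; have := hB w; positivity]
  refine Finset.sum_le_sum fun w _ ↦ (measure_union_le _ _).trans ?_
  have := hC₁ w; have := hC₂ w; have := hC₃ w; have hBw := hB w
  rw [add_mul, add_mul, ENNReal.ofReal_add (by positivity) (by positivity),
    ENNReal.ofReal_add (by positivity) (by positivity), mul_assoc, mul_assoc, mul_assoc]
  exact add_le_add (h₁ w _ (by positivity))
    ((measure_union_le _ _).trans (add_le_add (h₂ w _ (by positivity)) (h₃ w _ (by positivity))))

end NumberField.mixedEmbedding

end

/-! ### Lattice points in dilates of a bounded set. -/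

section

open MeasureTheory Pointwise

/-- Attach to each lattice point of `t • D` its translate of a fundamental domain of radius at most
`R`. The union has volume proportional to the count, and differs from `t • D` only at points that a
vector of length at most `R` carries across the boundary. After division by `t` these are controlled
by the hypothesis with `ε = R / t`. -/
theorem ZLattice.exists_card_inter_smul_sub_le {E : Type*} [NormedAddCommGroup E]
    [NormedSpace ℝ E] [FiniteDimensional ℝ E] [MeasurableSpace E] [BorelSpace E]
    (μ : Measure E) [μ.IsAddHaarMeasure] (L : Submodule ℤ E) [DiscreteTopology L] [IsZLattice ℝ L]
    {D : Set E} (hD : Bornology.IsBounded D) (hDm : MeasurableSet D) {C₀ : ℝ} (hC₀ : 0 ≤ C₀)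
    (hbd : ∀ ε : ℝ, 0 < ε → ε ≤ 1 →
      μ {x | ∃ u, ‖u‖ ≤ ε ∧ ¬ (x ∈ D ↔ x + u ∈ D)} ≤ ENNReal.ofReal (C₀ * √ε)) :
    ∃ κ C T : ℝ, ∀ t : ℝ, T ≤ t →
      |(Nat.card ↑(t • D ∩ (L : Set E)) : ℝ) - κ * t ^ Module.finrank ℝ E| ≤
        C * (t ^ Module.finrank ℝ E / √t) := by
  classical
  let b := Module.Free.chooseBasis ℤ L
  let B := b.ofZLatticeBasis ℝ L
  set F := ZSpan.fundamentalDomain B with hF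
  have hFb : Bornology.IsBounded F := ZSpan.fundamentalDomain_isBounded B
  have hFm : MeasurableSet F := ZSpan.fundamentalDomain_measurableSet B
  obtain ⟨R, hR0, hR⟩ := hFb.exists_pos_norm_le
  have hF0 : 0 < μ.real F := ENNReal.toReal_pos (ZSpan.measure_fundamentalDomain_ne_zero B)
    hFb.measure_lt_top.ne
  have hLspan : Submodule.span ℤ (Set.range B) = L := b.ofZLatticeBasis_span ℝ
  refine ⟨μ.real D / μ.real F, C₀ * √R / μ.real F, max R 1, fun t ht ↦ ?_⟩
  have ht0 : 0 < t := zero_lt_one.trans_le ((le_max_right _ _).trans ht)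
  have htR : R / t ≤ 1 := (div_le_one ht0).mpr ((le_max_left _ _).trans ht)
  have htD : Bornology.IsBounded (t • D) := hD.smul₀ t
  have hfin : (t • D ∩ (L : Set E)).Finite := by
    rw [← hLspan]
    exact ZSpan.setFinite_inter B htD
  set S := hfin.toFinset with hS
  have hcard : Nat.card ↑(t • D ∩ (L : Set E)) = S.card := by
    rw [Nat.card_coe_set_eq, Set.ncard_eq_toFinset_card _ hfin]
  let A : E → Set E := fun l ↦ (fun x ↦ x - l) ⁻¹' F
  have hAm : ∀ l, MeasurableSet (A l) := fun l ↦ hFm.preimage (by fun_prop)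
  have hAμ : ∀ l, μ (A l) = μ F := fun l ↦ by
    simp only [A, sub_eq_add_neg]
    exact measure_preimage_add_right μ (-l) F
  have hA : ∀ l ∈ L, ∀ x ∈ A l, ZSpan.fract B x = x - l := by
    intro l hl x hx
    have h1 : ZSpan.fract B (x - l) = x - l := (ZSpan.fract_eq_self).mpr hx
    rw [← h1, sub_eq_neg_add, ZSpan.fract_zSpan_add]
    rw [hLspan]
    exact L.neg_mem hl
  have hSL : ∀ l ∈ S, l ∈ L := fun l hl ↦ (hfin.mem_toFinset.mp hl).2
  have hSD : ∀ l ∈ S, l ∈ t • D := fun l hl ↦ (hfin.mem_toFinset.mp hl).1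
  set U := ⋃ l ∈ S, A l with hU
  have hdisj : Set.PairwiseDisjoint (↑S) A := by
    intro l hl l' hl' hne
    refine Set.disjoint_left.mpr fun x hx hx' ↦ hne ?_
    have h1 := hA l (hSL l hl) x hx
    rw [hA l' (hSL l' hl') x hx'] at h1
    exact (sub_right_injective h1).symm
  have hUμ : μ.real U = S.card * μ.real F := by
    rw [measureReal_def, hU, measure_biUnion_finset hdisj fun l _ ↦ hAm l]
    simp [hAμ, measureReal_def]
  have hUm : MeasurableSet U := Finset.measurableSet_biUnion _ fun l _ ↦ hAm l
  have hDtm : MeasurableSet (t • D) := hDm.const_smul₀ t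
  have hDtμ : μ.real (t • D) = t ^ Module.finrank ℝ E * μ.real D := by
    rw [measureReal_def, Measure.addHaar_smul, ENNReal.toReal_mul,
      ENNReal.toReal_ofReal (abs_nonneg _), abs_of_pos (by positivity), measureReal_def]
  have hsub : symmDiff U (t • D) ⊆
      t • {x | ∃ u, ‖u‖ ≤ R / t ∧ ¬ (x ∈ D ↔ x + u ∈ D)} := by
    have key : ∀ x u : E, ‖u‖ ≤ R → ¬ (x ∈ t • D ↔ x + u ∈ t • D) →
        x ∈ t • {x | ∃ u, ‖u‖ ≤ R / t ∧ ¬ (x ∈ D ↔ x + u ∈ D)} := by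
      intro x u hu hne
      rw [Set.mem_smul_set_iff_inv_smul_mem₀ ht0.ne']
      refine ⟨t⁻¹ • u, ?_, ?_⟩
      · rw [norm_smul, norm_inv, Real.norm_of_nonneg ht0.le, inv_mul_eq_div]
        gcongr
      · rwa [← smul_add, ← Set.mem_smul_set_iff_inv_smul_mem₀ ht0.ne',
          ← Set.mem_smul_set_iff_inv_smul_mem₀ ht0.ne']
    rintro x (⟨hxU, hxD⟩ | ⟨hxD, hxU⟩)
    · obtain ⟨l, hl, hx⟩ := Set.mem_iUnion₂.mp hxU
      refine key x (-(x - l)) (by rw [norm_neg]; exact hR _ hx) ?_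
      rw [show x + -(x - l) = l by abel]
      simp [hxD, hSD l hl]
    · refine key x (-ZSpan.fract B x) ?_ ?_
      · rw [norm_neg]
        exact hR _ (ZSpan.fract_mem_fundamentalDomain B x)
      · have hx : x + -ZSpan.fract B x = ZSpan.floor B x := by
          rw [ZSpan.fract_apply]; abel
        rw [hx]
        intro h
        refine hxU (Set.mem_iUnion₂.mpr ⟨ZSpan.floor B x, hfin.mem_toFinset.mpr
          ⟨h.mp hxD, ?_⟩, ?_⟩)
        · exact hLspan.le (ZSpan.floor B x).2
        · have := ZSpan.fract_mem_fundamentalDomain B x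
          rwa [ZSpan.fract_apply] at this
  have hUfin : μ U ≠ ⊤ := by
    rw [hU, measure_biUnion_finset hdisj fun l _ ↦ hAm l]
    simp only [hAμ]
    exact ENNReal.sum_ne_top.mpr fun _ _ ↦ hFb.measure_lt_top.ne
  have h1 : |μ.real U - μ.real (t • D)| ≤ t ^ Module.finrank ℝ E * (C₀ * √(R / t)) := by
    refine (abs_measureReal_sub_le_measureReal_symmDiff' hUm.nullMeasurableSet
      hDtm.nullMeasurableSet hUfin htD.measure_lt_top.ne).trans ?_
    refine ENNReal.toReal_le_of_le_ofReal (by positivity) ((measure_mono hsub).trans ?_)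
    rw [Measure.addHaar_smul, abs_of_pos (by positivity),
      ENNReal.ofReal_mul (by positivity : (0 : ℝ) ≤ t ^ Module.finrank ℝ E)]
    gcongr
    exact hbd _ (by positivity) htR
  rw [hUμ, hDtμ, Real.sqrt_div hR0.le] at h1
  rw [hcard]
  have h2 : (S.card : ℝ) - μ.real D / μ.real F * t ^ Module.finrank ℝ E =
      (S.card * μ.real F - t ^ Module.finrank ℝ E * μ.real D) / μ.real F := by
    field_simp
  rw [h2, abs_div, abs_of_pos hF0, div_le_iff₀ hF0]
  refine h1.trans (le_of_eq ?_)
  field_simp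

end

/-! ### Counting ideals with a power saving. -/

section

open NumberField NumberField.InfinitePlace NumberField.mixedEmbedding MeasureTheory
  Submodule NumberField.Units
open NumberField.mixedEmbedding.fundamentalCone Filter Asymptotics Pointwise Ideal
open scoped Classical nonZeroDivisors

namespace NumberField.Ideal

variable (K : Type*) [Field K] [NumberField K]

theorem smul_normLeOne {t : ℝ} (ht : 0 < t) :
    t • normLeOne K = {x ∈ fundamentalCone K | mixedEmbedding.norm x ≤
      t ^ Module.finrank ℚ K} := by
  ext x
  rw [Set.mem_smul_set_iff_inv_smul_mem₀ ht.ne', mem_normLeOne,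
    smul_mem_iff_mem (inv_ne_zero ht.ne'), mixedEmbedding.norm_smul, abs_of_pos (inv_pos.mpr ht),
    inv_pow, inv_mul_le_iff₀ (by positivity), mul_one]
  rfl

theorem exists_card_idealSet_sub_le (J : (Ideal (𝓞 K))⁰) :
    ∃ κ C T : ℝ, ∀ t : ℝ, T ≤ t →
      |(Nat.card {a : idealSet K J // mixedEmbedding.norm (a : mixedSpace K) ≤
        t ^ Module.finrank ℚ K} : ℝ) - κ * t ^ Module.finrank ℚ K| ≤
        C * (t ^ Module.finrank ℚ K / √t) := by
  obtain ⟨C₀, hC₀, h⟩ := volume_boundary_normLeOne_le (K := K)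
  obtain ⟨κ, C, T, h⟩ := ZLattice.exists_card_inter_smul_sub_le volume
    (mixedEmbedding.idealLattice K (FractionalIdeal.mk0 K J)) (isBounded_normLeOne K)
    (measurableSet_normLeOne K) hC₀ h
  refine ⟨κ, C, max T 1, fun t ht ↦ ?_⟩
  have ht0 : 0 < t := zero_lt_one.trans_le ((le_max_right _ _).trans ht)
  have := h t ((le_max_left _ _).trans ht)
  rw [mixedEmbedding.finrank] at this
  rw [smul_normLeOne K ht0] at this
  rwa [Nat.card_congr ((Equiv.subtypeSubtypeEquivSubtypeInter (· ∈ idealSet K J)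
    (fun a ↦ mixedEmbedding.norm a ≤ t ^ Module.finrank ℚ K)).trans
    (Equiv.subtypeEquivRight fun x ↦ ?_))]
  simp only [idealSet, Set.mem_inter_iff, Set.mem_sep_iff]
  tauto

/-- Multiplication by `J` carries the ideals of class `C` onto the principal multiples of `J`. -/
theorem card_norm_le_and_mk_eq {C : ClassGroup (𝓞 K)} {J : (Ideal (𝓞 K))⁰}
    (hJ : ClassGroup.mk0 J = C⁻¹) (s : ℝ) :
    Nat.card {I : (Ideal (𝓞 K))⁰ // absNorm (I : Ideal (𝓞 K)) ≤ s ∧ ClassGroup.mk0 I = C}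
      = Nat.card {I : (Ideal (𝓞 K))⁰ // (J : Ideal (𝓞 K)) ∣ I ∧ IsPrincipal (I : Ideal (𝓞 K)) ∧
        absNorm (I : Ideal (𝓞 K)) ≤ s * absNorm (J : Ideal (𝓞 K))} := by
  simp_rw [← nonZeroDivisors_dvd_iff_dvd_coe]
  refine Nat.card_congr ?_
  refine ((Equiv.dvd J).subtypeEquiv fun I ↦ ?_).trans
    (Equiv.subtypeSubtypeEquivSubtypeInter (fun I : (Ideal (𝓞 K))⁰ ↦ J ∣ I) _)
  rw [← ClassGroup.mk0_eq_one_iff (SetLike.coe_mem _)]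
  simp_rw [Equiv.dvd_apply, Submonoid.coe_mul, ← Submonoid.mul_def, _root_.map_mul, hJ,
    inv_mul_eq_one, Nat.cast_mul, mul_comm s, eq_comm, and_comm, and_congr_left_iff]
  exact fun _ ↦
    (mul_le_mul_iff_of_pos_left (Nat.cast_pos.mpr (absNorm_pos_of_nonZeroDivisors J))).symm

/-- Take `t = (s * N) ^ (1 / d)` in the lattice count: the saving `√t` becomes `s ^ (1 / (2d))`.
Each principal ideal is counted `torsionOrder K` times there, hence the division by `w`. -/
theorem exists_card_norm_le_and_mk_eq_sub_le (C : ClassGroup (𝓞 K)) :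
    ∃ κ B T : ℝ, ∀ s : ℝ, T ≤ s →
      |(Nat.card {I : (Ideal (𝓞 K))⁰ //
        absNorm (I : Ideal (𝓞 K)) ≤ s ∧ ClassGroup.mk0 I = C} : ℝ) - κ * s| ≤
        B * s ^ (1 - 1 / (2 * Module.finrank ℚ K) : ℝ) := by
  obtain ⟨J, hJ⟩ := ClassGroup.mk0_surjective C⁻¹
  obtain ⟨κ, B, T, h⟩ := exists_card_idealSet_sub_le K J
  set d := Module.finrank ℚ K with hd
  have hd0 : 0 < d := Module.finrank_pos
  set N : ℝ := (absNorm (J : Ideal (𝓞 K)) : ℝ) with hN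
  have hN0 : 0 < N := Nat.cast_pos.mpr (absNorm_pos_of_nonZeroDivisors J)
  set w : ℝ := (torsionOrder K : ℝ) with hw
  have hw0 : 0 < w := Nat.cast_pos.mpr (torsionOrder_pos K)
  refine ⟨κ * N / w, B * N ^ (1 - 1 / (2 * d) : ℝ) / w, max ((max T 1) ^ d / N) 1,
    fun s hs ↦ ?_⟩
  have hs0 : 0 < s := zero_lt_one.trans_le ((le_max_right _ _).trans hs)
  have hT : (max T 1) ^ d ≤ s * N := (div_le_iff₀ hN0).mp ((le_max_left _ _).trans hs)
  have ht : T ≤ (s * N) ^ (d⁻¹ : ℝ) := by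
    refine (le_max_left _ 1).trans ?_
    rw [← Real.pow_rpow_inv_natCast (zero_le_one.trans (le_max_right T 1)) hd0.ne']
    exact Real.rpow_le_rpow (by positivity) hT (by positivity)
  have := h _ ht
  rw [Real.rpow_inv_natCast_pow (by positivity) hd0.ne', ← card_isPrincipal_dvd_norm_le,
    ← card_norm_le_and_mk_eq K hJ, Nat.cast_mul, ← hw] at this
  have h1 : s * N / √((s * N) ^ (d⁻¹ : ℝ)) =
      N ^ (1 - 1 / (2 * d) : ℝ) * s ^ (1 - 1 / (2 * d) : ℝ) := by
    rw [← Real.mul_rpow hN0.le hs0.le, mul_comm N s, Real.sqrt_eq_rpow, ← Real.rpow_mul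
      (by positivity), Real.rpow_sub (by positivity), Real.rpow_one]
    congr 2
    field_simp
  rw [h1] at this
  have h2 : ∀ n : ℝ, n - κ * N / w * s = (n * w - κ * (s * N)) / w := fun n ↦ by field_simp
  rw [h2, abs_div, abs_of_pos hw0, div_le_iff₀ hw0]
  refine this.trans (le_of_eq ?_)
  field_simp

theorem card_norm_le_eq_sum_classes {s : ℝ} (hs : 0 ≤ s) :
    (Nat.card {I : (Ideal (𝓞 K))⁰ // absNorm (I : Ideal (𝓞 K)) ≤ s} : ℝ) =
      ∑ C : ClassGroup (𝓞 K), (Nat.card {I : (Ideal (𝓞 K))⁰ //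
        absNorm (I : Ideal (𝓞 K)) ≤ s ∧ ClassGroup.mk0 I = C} : ℝ) := by
  have : Fintype {I : (Ideal (𝓞 K))⁰ // absNorm (I : Ideal (𝓞 K)) ≤ s} := by
    simp_rw [← Nat.le_floor_iff hs]
    refine @Fintype.ofFinite _ (finite_setOfPred_absNorm_le₀ ⌊s⌋₊)
  let e := fun C : ClassGroup (𝓞 K) ↦ Equiv.subtypeSubtypeEquivSubtypeInter
    (fun I : (Ideal (𝓞 K))⁰ ↦ absNorm I.1 ≤ s) (fun I ↦ ClassGroup.mk0 I = C)
  simp_rw [← Nat.card_congr (e _), Nat.card_eq_fintype_card, Fintype.subtype_card]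
  rw [Fintype.card, Finset.card_eq_sum_card_fiberwise (f := fun I ↦ ClassGroup.mk0 I.1)
    (t := Finset.univ) (fun _ _ ↦ Finset.mem_univ _), Nat.cast_sum]

theorem exists_card_norm_le_sub_le :
    ∃ B T : ℝ, ∀ s : ℝ, T ≤ s →
      |(Nat.card {I : (Ideal (𝓞 K))⁰ // absNorm (I : Ideal (𝓞 K)) ≤ s} : ℝ) -
        dedekindZeta_residue K * s| ≤ B * s ^ (1 - 1 / (2 * Module.finrank ℚ K) : ℝ) := by
  choose κ B T h using exists_card_norm_le_and_mk_eq_sub_le K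
  have key : ∀ s : ℝ, 1 + ∑ C, |T C| ≤ s →
      |(Nat.card {I : (Ideal (𝓞 K))⁰ // absNorm (I : Ideal (𝓞 K)) ≤ s} : ℝ) -
        (∑ C, κ C) * s| ≤ (∑ C, B C) * s ^ (1 - 1 / (2 * Module.finrank ℚ K) : ℝ) := by
    intro s hs
    have hs0 : 0 ≤ s := le_trans (by positivity) hs
    rw [card_norm_le_eq_sum_classes K hs0, Finset.sum_mul, Finset.sum_mul,
      ← Finset.sum_sub_distrib]
    refine (Finset.abs_sum_le_sum_abs _ _).trans (Finset.sum_le_sum fun C _ ↦ h C s ?_)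
    refine le_trans ?_ hs
    have := Finset.single_le_sum (f := fun C ↦ |T C|) (fun _ _ ↦ abs_nonneg _)
      (Finset.mem_univ C)
    linarith [le_abs_self (T C)]
  have hlim : Tendsto (fun s : ℝ ↦ (Nat.card {I : (Ideal (𝓞 K))⁰ //
      absNorm (I : Ideal (𝓞 K)) ≤ s} : ℝ) / s) atTop (nhds (∑ C, κ C)) := by
    rw [tendsto_iff_norm_sub_tendsto_zero]
    have h0 : Tendsto (fun s : ℝ ↦ (∑ C, B C) * s ^ (-(1 / (2 * Module.finrank ℚ K)) : ℝ))
        atTop (nhds 0) := by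
      rw [← mul_zero (∑ C, B C)]
      have hd0 : 0 < Module.finrank ℚ K := Module.finrank_pos
      exact (tendsto_rpow_neg_atTop (by positivity)).const_mul _
    refine squeeze_zero' (.of_forall fun _ ↦ norm_nonneg _) ?_ h0
    filter_upwards [eventually_ge_atTop (1 + ∑ C, |T C|)] with s hs
    have hs0 : 0 < s := lt_of_lt_of_le (by positivity) hs
    have := key s hs
    rw [Real.norm_eq_abs, div_sub' hs0.ne', abs_div, abs_of_pos hs0, div_le_iff₀ hs0,
      mul_comm s, mul_assoc, ← Real.rpow_add_one hs0.ne', neg_add_eq_sub]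
    exact this
  -- The constants `κ C` need no computation: their sum is fixed by the known limit of the
  -- normalised count.
  have hκ : dedekindZeta_residue K = ∑ C, κ C :=
    tendsto_nhds_unique (tendsto_norm_le_div_atTop₀ K) hlim
  exact ⟨_, _, by simpa only [hκ] using key⟩

theorem sum_card_norm_eq (n : ℕ) :
    ∑ k ∈ Finset.Icc 1 n, Nat.card {I : Ideal (𝓞 K) // absNorm I = k} =
      Nat.card {I : (Ideal (𝓞 K))⁰ // absNorm (I : Ideal (𝓞 K)) ≤ n} := by
  -- The added `1` is the zero ideal, the only one of norm `0`.
  rw [← add_left_inj 1, ← card_norm_le_eq_card_norm_le_add_one,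
    show Finset.Icc 1 n = Finset.Ioc 0 n from Finset.Icc_succ_left_eq_Ioc _ _,
    show 1 = Nat.card {I : Ideal (𝓞 K) // absNorm I = 0} by simp [Ideal.absNorm_eq_zero_iff],
    Finset.sum_Ioc_add_eq_sum_Icc (n.zero_le),
    ← Finset.card_preimage_eq_sum_card_image_eq (fun k _ ↦ finite_setOfPred_absNorm_eq k)]
  simp [Set.coe_eq_subtype]

/-- The number of ideals of norm at most `X`, with a power saving in the error term. -/
theorem exists_sum_card_norm_sub_le :
    ∃ B : ℝ, ∀ X : ℝ, 1 ≤ X →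
      |(∑ k ∈ Finset.Icc 1 ⌊X⌋₊, (Nat.card {I : Ideal (𝓞 K) // absNorm I = k} : ℝ)) -
        dedekindZeta_residue K * X| ≤ B * X ^ (1 - 1 / (2 * Module.finrank ℚ K) : ℝ) := by
  obtain ⟨B, T, h⟩ := exists_card_norm_le_sub_le K
  have hd0 : 1 ≤ Module.finrank ℚ K := Module.finrank_pos
  have hd1 : (0 : ℝ) ≤ 1 - 1 / (2 * Module.finrank ℚ K) := by
    rw [sub_nonneg, div_le_one (by positivity)]
    have : (1 : ℝ) ≤ Module.finrank ℚ K := by exact_mod_cast hd0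
    linarith
  set S : ℝ → ℝ := fun X ↦
    ∑ k ∈ Finset.Icc 1 ⌊X⌋₊, (Nat.card {I : Ideal (𝓞 K) // absNorm I = k} : ℝ) with hS
  have hS0 : ∀ X, 0 ≤ S X := fun X ↦ Finset.sum_nonneg fun _ _ ↦ Nat.cast_nonneg _
  have hκ := dedekindZeta_residue_pos K
  -- The second entry covers `1 ≤ X < T`, where everything is bounded and the power of `X` is at
  -- least `1`.
  refine ⟨max B (S T + dedekindZeta_residue K * T), fun X hX ↦ ?_⟩
  have hX0 : 0 < X := by linarith
  rcases le_or_gt T X with hT | hT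
  · have := h X hT
    simp_rw [← Nat.le_floor_iff hX0.le, ← sum_card_norm_eq, Nat.cast_sum] at this
    exact this.trans (by gcongr; exact le_max_left _ _)
  · have h1 : S X ≤ S T := Finset.sum_le_sum_of_subset_of_nonneg
      (Finset.Icc_subset_Icc_right (Nat.floor_mono hT.le)) fun _ _ _ ↦ Nat.cast_nonneg _
    have h2 : dedekindZeta_residue K * X ≤ dedekindZeta_residue K * T := by gcongr
    have h3 : 0 ≤ dedekindZeta_residue K * X := by positivity
    have h4 : |S X - dedekindZeta_residue K * X| ≤ S T + dedekindZeta_residue K * T := by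
      rw [abs_le]
      constructor <;> linarith [hS0 X, hS0 T]
    refine h4.trans ((le_max_right B _).trans (le_mul_of_one_le_right ?_ ?_))
    · exact le_max_of_le_right (by linarith [hS0 T])
    · exact Real.one_le_rpow hX hd1

end NumberField.Ideal

end

/-! ### From summatory functions to continuations and convolutions. -/

section

open Filter Asymptotics MeasureTheory

/-- A Dirichlet series whose summatory function is `κ X + O(X ^ r)` extends to `Re s > r`, with
principal part `κ / (s - 1)` at `1`. -/
theorem LSeries.exists_continuation_of_sum_sub_le {f : ℕ → ℂ} {κ : ℂ} {B r : ℝ} (hr0 : 0 ≤ r)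
    (hr1 : r < 1) (hf : ∀ s : ℂ, 1 < s.re → LSeriesSummable f s)
    (h : ∀ X : ℝ, 1 ≤ X → ‖(∑ k ∈ Finset.Icc 1 ⌊X⌋₊, f k) - κ * X‖ ≤ B * X ^ r) :
    ∃ H : ℂ → ℂ, DifferentiableOn ℂ H {s | r < s.re} ∧
      ∀ s : ℂ, 1 < s.re → LSeries f s = κ * s / (s - 1) + s * H s := by
  have hB : 0 ≤ B := by simpa using (norm_nonneg _).trans (h 1 le_rfl)
  set S : ℝ → ℂ := fun t ↦ ∑ k ∈ Finset.Icc 1 ⌊t⌋₊, f k with hS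
  have hSm : Measurable S :=
    (measurable_from_nat (f := fun n : ℕ ↦ ∑ k ∈ Finset.Icc 1 n, f k)).comp Nat.measurable_floor
  -- Cutting off at `1` makes the Mellin transform harmless at `0`; only the growth `t ^ r` at
  -- infinity restricts `s`.
  set E : ℝ → ℂ := (Set.Ioi 1).indicator fun t ↦ S t - κ * t with hE
  have hEm : Measurable E := (hSm.sub (by fun_prop)).indicator measurableSet_Ioi
  have hEle : ∀ t, ‖E t‖ ≤ ‖B * t ^ r‖ := by
    intro t
    by_cases ht : 1 < t
    · rw [hE, Set.indicator_of_mem (Set.mem_Ioi.mpr ht)]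
      exact (h t ht.le).trans (le_abs_self _)
    · rw [hE, Set.indicator_of_notMem (by simpa using ht), norm_zero]
      exact norm_nonneg _
  have hloc : LocallyIntegrableOn E (Set.Ioi 0) := by
    have hc : Continuous fun t : ℝ ↦ B * t ^ r :=
      continuous_const.mul (Real.continuous_rpow_const hr0)
    exact (hc.locallyIntegrable.locallyIntegrableOn _).mono hEm.aestronglyMeasurable
      (.of_forall hEle)
  have htop : E =O[atTop] (· ^ (- -r) : ℝ → ℝ) := by
    rw [neg_neg]
    exact (IsBigO.of_bound 1 (.of_forall (by simpa using hEle))).trans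
      (isBigO_const_mul_self B (fun t : ℝ ↦ t ^ r) atTop)
  have hbot : ∀ b : ℝ, E =O[nhdsWithin 0 (Set.Ioi 0)] (· ^ (-b) : ℝ → ℝ) := by
    intro b
    have h0 : E =ᶠ[nhdsWithin 0 (Set.Ioi 0)] fun _ ↦ (0 : ℂ) := by
      filter_upwards [nhdsWithin_le_nhds (Iio_mem_nhds (zero_lt_one (α := ℝ)))] with t ht
      rw [hE, Set.indicator_of_notMem (by simpa using ht.le)]
    exact h0.trans_isBigO (isBigO_zero _ _)
  -- In `s ∫ S(t) t ^ (-s-1) dt` the part `κ t` of `S` gives the pole and the remainder `E` gives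
  -- `H`.
  refine ⟨fun s ↦ mellin E (-s), fun s hs ↦ ?_, fun s hs ↦ ?_⟩
  · have : DifferentiableAt ℂ (mellin E) (-s) :=
      mellin_differentiableAt_of_isBigO_rpow (a := -r) (b := (-s).re - 1) hloc htop
        (by simpa using hs) (hbot _) (by simp)
    exact (DifferentiableAt.comp (f := fun s : ℂ ↦ -s) s this (by fun_prop)).differentiableWithinAt
  · have hs0 : s ≠ 0 := by rintro rfl; simp at hs; linarith
    have hs1 : s - 1 ≠ 0 := by
      intro h; rw [sub_eq_zero] at h; subst h; simp at hs
    have hO : (fun n : ℕ ↦ ∑ k ∈ Finset.Icc 1 n, f k) =O[atTop] fun n ↦ (n : ℝ) ^ (1 : ℝ) := by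
      refine IsBigO.of_bound (B + ‖κ‖) ?_
      filter_upwards [eventually_ge_atTop 1] with n hn
      have hn' : (1 : ℝ) ≤ n := by exact_mod_cast hn
      have h1 := h n hn'
      rw [Nat.floor_natCast] at h1
      have h2 := norm_add_le ((∑ k ∈ Finset.Icc 1 n, f k) - κ * (n : ℝ)) (κ * (n : ℝ))
      rw [sub_add_cancel, norm_mul, Complex.norm_real] at h2
      have h3 : B * (n : ℝ) ^ r ≤ B * n := by
        gcongr
        simpa using Real.rpow_le_rpow_of_exponent_le hn' hr1.le
      rw [Real.rpow_one, Real.norm_of_nonneg (Nat.cast_nonneg n)] at *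
      linarith
    rw [LSeries_eq_mul_integral f zero_le_one hs (hf s hs) hO]
    have hconv : MellinConvergent E (-s) :=
      mellinConvergent_of_isBigO_rpow (a := -r) (b := (-s).re - 1) hloc htop
        (by simp; linarith) (hbot _) (by simp)
    have hmellin : mellin E (-s) =
        ∫ t in Set.Ioi (1 : ℝ), (t : ℂ) ^ (-s - 1) * (S t - κ * t) := by
      rw [mellin]
      simp only [smul_eq_mul]
      have h1 : (fun t : ℝ ↦ (t : ℂ) ^ (-s - 1) * E t) =
          (Set.Ioi 1).indicator fun t : ℝ ↦ (t : ℂ) ^ (-s - 1) * (S t - κ * t) := by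
        ext t
        by_cases ht : t ∈ Set.Ioi (1 : ℝ)
        · simp only [hE, Set.indicator_of_mem ht]
        · simp only [hE, Set.indicator_of_notMem ht, mul_zero]
      rw [h1, setIntegral_indicator measurableSet_Ioi]
      congr 2
      rw [Set.Ioi_inter_Ioi]; simp
    have hint1 : IntegrableOn (fun t : ℝ ↦ (t : ℂ) ^ (-s - 1) * (S t - κ * t)) (Set.Ioi 1) := by
      refine (hconv.mono_set (Set.Ioi_subset_Ioi zero_le_one)).congr_fun (fun t ht ↦ ?_)
        measurableSet_Ioi
      simp only [hE, Set.indicator_of_mem ht, smul_eq_mul]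
    have hint2 : IntegrableOn (fun t : ℝ ↦ κ * (t : ℂ) ^ (-s)) (Set.Ioi 1) :=
      (integrableOn_Ioi_cpow_of_lt (by simpa using hs) zero_lt_one).const_mul κ
    have hsplit : ∫ t in Set.Ioi (1 : ℝ), S t * (t : ℂ) ^ (-(s + 1)) =
        mellin E (-s) + κ / (s - 1) := by
      have h2 : ∫ t in Set.Ioi (1 : ℝ), κ * (t : ℂ) ^ (-s) = κ / (s - 1) := by
        rw [integral_const_mul, integral_Ioi_cpow_of_lt (by simpa using hs) zero_lt_one]
        have : -s + 1 ≠ 0 := by rw [show -s + 1 = -(s - 1) by ring]; exact neg_ne_zero.mpr hs1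
        simp only [Complex.ofReal_one, Complex.one_cpow]
        field_simp
        ring
      rw [hmellin, ← h2, ← integral_add hint1 hint2]
      refine setIntegral_congr_fun measurableSet_Ioi fun t ht ↦ ?_
      have ht0 : (t : ℂ) ≠ 0 := by exact_mod_cast (zero_lt_one.trans ht).ne'
      have h3 : (t : ℂ) ^ (-s) = (t : ℂ) ^ (-s - 1) * t := by
        rw [Complex.cpow_sub _ _ ht0, Complex.cpow_one, div_mul_cancel₀ _ ht0]
      rw [h3, neg_add']
      ring
    rw [hsplit]
    field_simp
    ring

/-- The summatory function of a Dirichlet convolution `g * a`, when that of `a` is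
`κ X + O(X ^ r)` and the Dirichlet series of `g` converges absolutely at `r`. -/
theorem ArithmeticFunction.exists_sum_mul_sub_le {a g : ArithmeticFunction ℂ} {κ : ℂ} {B r : ℝ}
    (hr1 : r < 1) (hg : LSeriesSummable g r)
    (h : ∀ X : ℝ, 1 ≤ X → ‖(∑ k ∈ Finset.Icc 1 ⌊X⌋₊, a k) - κ * X‖ ≤ B * X ^ r) :
    ∃ C : ℝ, ∀ X : ℝ, 1 ≤ X →
      ‖(∑ k ∈ Finset.Icc 1 ⌊X⌋₊, (g * a) k) - LSeries g 1 * κ * X‖ ≤ C * X ^ r := by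
  set S : ℝ → ℂ := fun t ↦ ∑ k ∈ Finset.Icc 1 ⌊t⌋₊, a k with hS
  set D := max B ‖κ‖ with hD
  -- The bound is also needed at `Y = X / d < 1`, where `S` vanishes and `Y ≤ Y ^ r`. The sum over
  -- `d` can then run over all integers, with no tail to treat.
  have key : ∀ Y : ℝ, 0 < Y → ‖S Y - κ * Y‖ ≤ D * Y ^ r := by
    intro Y hY
    rcases le_or_gt 1 Y with h1 | h1
    · exact (h Y h1).trans (by gcongr; exact le_max_left _ _)
    · have : S Y = 0 := by simp [hS, Nat.floor_eq_zero.mpr h1]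
      rw [this, zero_sub, norm_neg, norm_mul, Complex.norm_real, Real.norm_of_nonneg hY.le]
      gcongr
      · exact le_max_right _ _
      · simpa using Real.rpow_le_rpow_of_exponent_ge hY h1.le hr1.le
  refine ⟨D * ∑' n, ‖LSeries.term g r n‖, fun X hX ↦ ?_⟩
  have hX0 : 0 < X := by linarith
  set N := ⌊X⌋₊ with hN
  have hg1 : LSeriesSummable g 1 := hg.of_re_le_re (by simpa using hr1.le)
  have hsum : ∑ k ∈ Finset.Icc 1 N, (g * a) k = ∑' d : ℕ, g d * S (X / d) := by
    have h1 := ArithmeticFunction.sum_Ioc_mul_eq_sum_sum g a N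
    simp only [← Finset.Icc_succ_left_eq_Ioc, Order.succ_eq_add_one, zero_add] at h1
    rw [h1, tsum_eq_sum (s := Finset.Icc 1 N)]
    · refine Finset.sum_congr rfl fun d _ ↦ ?_
      rw [hS, hN]
      simp only [Nat.floor_div_natCast]
    · intro d hd
      rcases Nat.eq_zero_or_pos d with rfl | hd0
      · simp
      · have : N < d := by
          by_contra! hle
          exact hd (Finset.mem_Icc.mpr ⟨hd0, hle⟩)
        have : ⌊X / d⌋₊ = 0 := by
          rw [Nat.floor_div_natCast]
          exact Nat.div_eq_of_lt this
        simp [hS, this]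
  have hterm : ∀ d : ℕ, g d * S (X / d) - LSeries.term g 1 d * κ * X =
      g d * (S (X / d) - κ * ((X / d : ℝ) : ℂ)) := by
    intro d
    rcases eq_or_ne d 0 with rfl | hd
    · simp
    · rw [LSeries.term_of_ne_zero hd]
      have : (d : ℂ) ≠ 0 := by exact_mod_cast hd
      push_cast
      rw [Complex.cpow_one]
      field_simp
  have hbound : ∀ d : ℕ, ‖g d * (S (X / d) - κ * ((X / d : ℝ) : ℂ))‖ ≤
      D * X ^ r * ‖LSeries.term g r d‖ := by
    intro d
    rcases eq_or_ne d 0 with rfl | hd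
    · simp
    · have hd0 : (0 : ℝ) < d := by exact_mod_cast Nat.pos_of_ne_zero hd
      rw [norm_mul, LSeries.norm_term_eq, if_neg hd, Complex.ofReal_re]
      calc ‖g d‖ * ‖S (X / d) - κ * ((X / d : ℝ) : ℂ)‖ ≤ ‖g d‖ * (D * (X / d) ^ r) := by
            gcongr; exact key _ (by positivity)
        _ = _ := by rw [Real.div_rpow hX0.le hd0.le]; ring
  have hs2 : Summable fun d : ℕ ↦ g d * (S (X / d) - κ * ((X / d : ℝ) : ℂ)) :=
    .of_norm_bounded (hg.norm.mul_left _) hbound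
  have hs1 : Summable fun d : ℕ ↦ LSeries.term g 1 d * κ * X := (hg1.mul_right κ).mul_right _
  have heq : (∑' d : ℕ, g d * S (X / d)) - LSeries g 1 * κ * X =
      ∑' d : ℕ, g d * (S (X / d) - κ * ((X / d : ℝ) : ℂ)) := by
    have hs3 : Summable fun d : ℕ ↦ g d * S (X / d) := by
      refine (hs2.add hs1).congr fun d ↦ ?_
      rw [← hterm]; ring
    rw [LSeries, ← tsum_mul_right, ← tsum_mul_right, ← hs3.tsum_sub hs1]
    exact tsum_congr hterm
  rw [hsum, heq]
  refine (tsum_of_norm_bounded (hg.norm.mul_left _).hasSum hbound).trans (le_of_eq ?_)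
  rw [tsum_mul_left]
  ring

end

/-! ### The inverse of the Dedekind zeta function as an Euler product. -/

section

open ArithmeticFunction PowerSeries IsDedekindDomain Ideal NumberField Filter

open scoped Classical

theorem ArithmeticFunction.ofPowerSeries_one_sub_X_mul_apply {R : Type*} [CommRing R] {q : ℕ}
    (hq : 1 < q) (h : ArithmeticFunction R) {n : ℕ} (hn : n ≠ 0) :
    (ofPowerSeries q (1 - X : PowerSeries R) * h) n = h n - if q ∣ n then h (n / q) else 0 := by
  have hX : ∀ d, ofPowerSeries q (X : PowerSeries R) d = if d = q then 1 else 0 := by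
    intro d
    rw [ofPowerSeries_apply hq]
    by_cases hd : ∃ i, q ^ i = d
    · obtain ⟨i, rfl⟩ := hd
      rw [(Nat.pow_right_injective hq).extend_apply, coeff_X]
      have : q ^ i = q ↔ i = 1 :=
        ⟨fun h ↦ Nat.pow_right_injective hq (by simpa using h), by rintro rfl; simp⟩
      simp only [this]
    · rw [Function.extend_apply' _ _ _ hd, if_neg, Pi.zero_apply]
      rintro rfl
      exact hd ⟨1, pow_one _⟩
  have key : (ofPowerSeries q (X : PowerSeries R) * h) n = if q ∣ n then h (n / q) else 0 := by
    rw [mul_apply, Nat.sum_divisorsAntidiagonal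
      (f := fun d e ↦ ofPowerSeries q (X : PowerSeries R) d * h e)]
    simp [hX, hn]
  rw [map_sub, map_one, sub_mul, one_mul, ← key, eq_sub_iff_add_eq, ← add_apply, sub_add_cancel]

namespace NumberField

variable (K : Type*) [Field K] [NumberField K]

/-- The number of ideals of `𝓞 K` of norm `n`, for `n ≠ 0`. -/
noncomputable def idealCount : ArithmeticFunction ℂ :=
  ⟨fun n ↦ if n = 0 then 0 else Nat.card {I : Ideal (𝓞 K) // absNorm I = n}, by simp⟩

/-- The Dirichlet series `1 - N(P) ^ (-s)`. -/
noncomputable def eulerFactor (P : HeightOneSpectrum (𝓞 K)) : ArithmeticFunction ℂ :=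
  ofPowerSeries (absNorm P.asIdeal) (1 - X)

/-- The coefficients of the inverse of the Dedekind zeta function. -/
noncomputable def idealMoebius : ArithmeticFunction ℂ :=
  eulerProduct (eulerFactor K)

/-- The number of ideals of norm `n ≠ 0` all whose prime factors lie in `T`. -/
noncomputable def factoredIdealCount (T : Finset (HeightOneSpectrum (𝓞 K))) :
    ArithmeticFunction ℂ :=
  ⟨fun n ↦ if n = 0 then 0 else ({I : Ideal (𝓞 K) | absNorm I = n ∧
    ∀ P : HeightOneSpectrum (𝓞 K), P.asIdeal ∣ I → P ∈ T}.ncard : ℂ), by simp⟩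

variable {K}

theorem one_lt_absNorm (P : HeightOneSpectrum (𝓞 K)) : 1 < absNorm P.asIdeal := by
  have h0 : absNorm P.asIdeal ≠ 0 := absNorm_ne_zero_iff_mem_nonZeroDivisors.mpr
    (mem_nonZeroDivisors_of_ne_zero P.ne_bot)
  have h1 : absNorm P.asIdeal ≠ 1 := by
    rw [Ne, absNorm_eq_one_iff]; exact P.isPrime.ne_top
  omega

instance : Northcott fun P : HeightOneSpectrum (𝓞 K) ↦ absNorm P.asIdeal where
  finite_le b := by
    have h := (finite_setOfPred_absNorm_le (S := 𝓞 K) b).preimage (f := HeightOneSpectrum.asIdeal)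
      (fun P _ Q _ h ↦ HeightOneSpectrum.ext h)
    exact h

theorem eulerFactor_mul_apply (P : HeightOneSpectrum (𝓞 K)) (h : ArithmeticFunction ℂ) {n : ℕ}
    (hn : n ≠ 0) : (eulerFactor K P * h) n =
      h n - if absNorm P.asIdeal ∣ n then h (n / absNorm P.asIdeal) else 0 :=
  ofPowerSeries_one_sub_X_mul_apply (one_lt_absNorm P) h hn

/-- Among the ideals supported on `insert P T`, the multiples of `P` are exactly the products `P *
J` with `J` of the same kind. The Euler factor subtracts them. -/
theorem eulerFactor_mul_factoredIdealCount_insert {P : HeightOneSpectrum (𝓞 K)}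
    {T : Finset (HeightOneSpectrum (𝓞 K))} (hP : P ∉ T) :
    eulerFactor K P * factoredIdealCount K (insert P T) = factoredIdealCount K T := by
  ext n
  rcases eq_or_ne n 0 with rfl | hn
  · simp
  rw [eulerFactor_mul_apply P _ hn, sub_eq_iff_eq_add]
  set S : Finset (HeightOneSpectrum (𝓞 K)) → ℕ → Set (Ideal (𝓞 K)) := fun T n ↦
    {I : Ideal (𝓞 K) | absNorm I = n ∧ ∀ P : HeightOneSpectrum (𝓞 K), P.asIdeal ∣ I → P ∈ T}
    with hS
  have mem_S : ∀ T n I, I ∈ S T n ↔ absNorm I = n ∧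
      ∀ P : HeightOneSpectrum (𝓞 K), P.asIdeal ∣ I → P ∈ T := fun _ _ _ ↦ Iff.rfl
  have mem_sep : ∀ T n (p : Ideal (𝓞 K) → Prop) I, I ∈ {I ∈ S T n | p I} ↔ I ∈ S T n ∧ p I :=
    fun _ _ _ _ ↦ Iff.rfl
  have hfin : ∀ T n, (S T n).Finite := fun T n ↦
    (finite_setOfPred_absNorm_eq (S := 𝓞 K) n).subset fun I hI ↦ hI.1
  have happ : ∀ T n, n ≠ 0 → factoredIdealCount K T n = ((S T n).ncard : ℂ) := fun T n h ↦ by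
    simp [factoredIdealCount, h, hS]
  clear_value S
  have hPp : Prime P.asIdeal := P.prime
  have hNP : absNorm P.asIdeal ≠ 0 := (zero_lt_one.trans (one_lt_absNorm P)).ne'
  rw [happ _ _ hn, happ _ _ hn]
  have hsub : {I ∈ S (insert P T) n | ¬ P.asIdeal ∣ I} = S T n := by
    ext I
    simp only [mem_sep]
    simp only [mem_S, Finset.mem_insert]
    constructor
    · rintro ⟨⟨h1, h2⟩, h3⟩
      refine ⟨h1, fun Q hQ ↦ (h2 Q hQ).resolve_left ?_⟩
      rintro rfl
      exact h3 hQ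
    · rintro ⟨h1, h2⟩
      exact ⟨⟨h1, fun Q hQ ↦ .inr (h2 Q hQ)⟩, fun h ↦ hP (h2 P h)⟩
  have hsplit : (S (insert P T) n).ncard =
      (S T n).ncard + {I ∈ S (insert P T) n | P.asIdeal ∣ I}.ncard := by
    rw [← hsub, ← Set.ncard_union_eq _ ((hfin _ _).subset (Set.sep_subset _ _))
      ((hfin _ _).subset (Set.sep_subset _ _))]
    · congr 1
      ext I
      simp only [Set.mem_union, mem_sep]
      tauto
    · rw [Set.disjoint_left]
      exact fun I h1 h2 ↦ h1.2 h2.2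
  rw [hsplit, Nat.cast_add]
  congr 1
  split_ifs with hd
  · obtain ⟨j, rfl⟩ := hd
    have hj : j ≠ 0 := right_ne_zero_of_mul hn
    rw [Nat.mul_div_cancel_left _ (Nat.pos_of_ne_zero hNP), happ _ _ hj]
    congr 1
    rw [← Set.ncard_image_of_injective (S (insert P T) j) (mul_right_injective₀ hPp.ne_zero)]
    congr 1
    ext I
    simp only [Set.mem_image, mem_sep]
    simp only [mem_S]
    constructor
    · rintro ⟨⟨h1, h2⟩, J, rfl⟩
      rw [map_mul] at h1
      exact ⟨J, ⟨mul_left_cancel₀ hNP h1, fun Q hQ ↦ h2 Q (hQ.mul_left _)⟩, rfl⟩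
    · rintro ⟨J, ⟨h1, h2⟩, rfl⟩
      refine ⟨⟨by rw [map_mul, h1], fun Q hQ ↦ ?_⟩, dvd_mul_right _ _⟩
      rcases Q.prime.dvd_or_dvd hQ with h | h
      · rw [Finset.mem_insert]
        left
        have := (Prime.dvd_prime_iff_associated Q.prime hPp).mp h
        exact HeightOneSpectrum.ext (associated_iff_eq.mp this)
      · exact h2 Q h
  · have : {I ∈ S (insert P T) n | P.asIdeal ∣ I} = ∅ := by
      ext I
      simp only [Set.mem_empty_iff_false, iff_false, mem_sep]
      simp only [mem_S]
      rintro ⟨⟨rfl, -⟩, h⟩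
      exact hd (map_dvd absNorm h)
    rw [this]; simp

theorem factoredIdealCount_empty : factoredIdealCount K ∅ = 1 := by
  ext n
  rcases eq_or_ne n 0 with rfl | hn
  · simp
  have h : ∀ I : Ideal (𝓞 K), (absNorm I = n ∧ ∀ P : HeightOneSpectrum (𝓞 K), P.asIdeal ∣ I →
      P ∈ (∅ : Finset (HeightOneSpectrum (𝓞 K)))) ↔ I = 1 ∧ n = 1 := by
    intro I
    constructor
    · rintro ⟨h1, h2⟩
      have hI : I = 1 := by
        by_contra hI
        have hI0 : I ≠ 0 := by rintro rfl; simp at h1; exact hn h1.symm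
        obtain ⟨P, hP, hPI⟩ := exists_le_maximal I (by rwa [← one_eq_top])
        have hPb : P ≠ ⊥ := by rintro rfl; exact hI0 (le_bot_iff.mp hPI)
        simpa using h2 ⟨P, hP.isPrime, hPb⟩ (dvd_iff_le.mpr hPI)
      subst hI
      exact ⟨rfl, by rw [← h1]; simp⟩
    · rintro ⟨rfl, rfl⟩
      exact ⟨by simp, fun P hP ↦ absurd (isUnit_of_dvd_one hP) P.prime.not_isUnit⟩
  rw [factoredIdealCount, coe_mk, if_neg hn]
  simp only [h]
  rw [one_apply]
  split_ifs with h1 <;> simp [h1]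

theorem prod_eulerFactor_mul_factoredIdealCount (T : Finset (HeightOneSpectrum (𝓞 K))) :
    (∏ P ∈ T, eulerFactor K P) * factoredIdealCount K T = 1 := by
  induction T using Finset.induction_on with
  | empty => simp [factoredIdealCount_empty]
  | insert P T hP ih =>
    rw [Finset.prod_insert hP, mul_comm (eulerFactor K P), mul_assoc,
      eulerFactor_mul_factoredIdealCount_insert hP, ih]

theorem factoredIdealCount_apply_of_forall {T : Finset (HeightOneSpectrum (𝓞 K))} {n : ℕ}
    (h : ∀ P : HeightOneSpectrum (𝓞 K), absNorm P.asIdeal ≤ n → P ∈ T) :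
    factoredIdealCount K T n = idealCount K n := by
  rcases eq_or_ne n 0 with rfl | hn
  · simp
  rw [factoredIdealCount, idealCount, coe_mk, coe_mk, if_neg hn, if_neg hn]
  refine congrArg Nat.cast ?_
  rw [← Nat.card_coe_set_eq]
  refine Nat.card_congr (Equiv.subtypeEquivRight fun I ↦ ⟨fun hI ↦ hI.1, fun hI ↦ ⟨hI, ?_⟩⟩)
  intro P hP
  refine h P (Nat.le_of_dvd (Nat.pos_of_ne_zero hn) ?_)
  rw [← hI]
  exact map_dvd absNorm hP

theorem eventually_prod_eulerFactor_apply (n : ℕ) :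
    ∀ᶠ S in atTop, (∏ P ∈ S, eulerFactor K P) n = idealMoebius K n :=
  tendsTo_eulerProduct_ofPowerSeries (fun P : HeightOneSpectrum (𝓞 K) ↦ absNorm P.asIdeal)
    (fun _ ↦ 1 - X) (by simp) n

theorem isMultiplicative_idealMoebius : (idealMoebius K).IsMultiplicative := by
  refine isMultiplicative_eulerProduct _ fun P ↦ ?_
  refine isMultiplicative_ofPowerSeries_of_isPrimePow _ ?_ _ (by simp)
  have := P.isMaximal
  obtain ⟨p, n, hn, -, hp, h⟩ := Ideal.exists_prime_and_absNorm_eq_pow P.asIdeal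
  exact ⟨p, n, hp.prime, hn, h.symm⟩

/-- The value at `n` involves only the primes of norm at most `n`. Once a finite set contains these
and the partial Euler products have stabilised up to `n`, the finite identity applies. -/
theorem idealMoebius_mul_idealCount : idealMoebius K * idealCount K = 1 := by
  ext n
  have h1 : ∀ᶠ S : Finset (HeightOneSpectrum (𝓞 K)) in atTop, ∀ k ∈ Finset.range (n + 1),
      (∏ P ∈ S, eulerFactor K P) k = idealMoebius K k :=
    (Finset.eventually_all _).mpr fun k _ ↦ eventually_prod_eulerFactor_apply k
  have h2 : ∀ᶠ S : Finset (HeightOneSpectrum (𝓞 K)) in atTop,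
      ∀ P : HeightOneSpectrum (𝓞 K), absNorm P.asIdeal ≤ n → P ∈ S := by
    have hf := Northcott.finite_le (h := fun P : HeightOneSpectrum (𝓞 K) ↦ absNorm P.asIdeal) n
    filter_upwards [eventually_ge_atTop hf.toFinset] with S hS P hP
    exact hS (hf.mem_toFinset.mpr hP)
  obtain ⟨S, hS1, hS2⟩ := (h1.and h2).exists
  rw [← prod_eulerFactor_mul_factoredIdealCount S, mul_apply, mul_apply]
  refine Finset.sum_congr rfl fun d hd ↦ ?_
  have hd1 : d.1 ≤ n := Nat.divisor_le (Nat.fst_mem_divisors_of_mem_antidiagonal hd)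
  have hd2 : d.2 ≤ n := Nat.divisor_le (Nat.snd_mem_divisors_of_mem_antidiagonal hd)
  rw [hS1 d.1 (by simpa [Nat.lt_succ_iff] using hd1),
    factoredIdealCount_apply_of_forall fun P hP ↦ hS2 P (hP.trans hd2)]

theorem idealMoebius_apply_prime {p : ℕ} (hp : p.Prime) :
    idealMoebius K p = -idealCount K p := by
  have h := congrArg (fun f : ArithmeticFunction ℂ ↦ f p) (idealMoebius_mul_idealCount (K := K))
  have h1 := congrArg (fun f : ArithmeticFunction ℂ ↦ f 1) (idealMoebius_mul_idealCount (K := K))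
  have hm : idealMoebius K 1 = 1 := isMultiplicative_idealMoebius.1
  simp only [mul_apply, one_apply_ne hp.ne_one, one_apply, Nat.divisorsAntidiagonal_one,
    Finset.sum_singleton, hm, one_mul, if_true] at h h1
  rw [Nat.sum_divisorsAntidiagonal (f := fun d e ↦ idealMoebius K d * idealCount K e),
    hp.sum_divisors, Nat.div_self hp.pos, Nat.div_one, hm, h1, one_mul, mul_one] at h
  linear_combination h

/-- The product of these primes divides `(p)`, whose norm is `p ^ d`, and each has norm at least
`p`. -/
theorem card_le_finrank_of_absNorm_eq_pow {p : ℕ} (hp : p.Prime)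
    (T : Finset (HeightOneSpectrum (𝓞 K))) (hT : ∀ P ∈ T, ∃ f, absNorm P.asIdeal = p ^ f) :
    T.card ≤ Module.finrank ℚ K := by
  have hmem : ∀ P ∈ T, P.asIdeal ∣ span {(p : 𝓞 K)} := by
    intro P hP
    obtain ⟨f, hf⟩ := hT P hP
    rw [dvd_span_singleton]
    have := absNorm_mem P.asIdeal
    rw [hf, Nat.cast_pow] at this
    exact P.isPrime.mem_of_pow_mem _ this
  have hdvd : ∏ I ∈ T.image HeightOneSpectrum.asIdeal, I ∣ span {(p : 𝓞 K)} := by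
    refine Finset.prod_primes_dvd _ ?_ ?_
    · simp only [Finset.mem_image, forall_exists_index, and_imp, forall_apply_eq_imp_iff₂]
      exact fun P _ ↦ P.prime
    · simpa using hmem
  rw [Finset.prod_image fun P _ Q _ h ↦ HeightOneSpectrum.ext h] at hdvd
  have h2 := map_dvd absNorm hdvd
  rw [map_prod, absNorm_span_natCast, RingOfIntegers.rank] at h2
  have h3 := Nat.le_of_dvd (pow_pos hp.pos _) h2
  refine (Nat.pow_le_pow_iff_right hp.one_lt).mp (le_trans ?_ h3)
  rw [← Finset.prod_const]
  refine Finset.prod_le_prod' fun P hP ↦ ?_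
  obtain ⟨f, hf⟩ := hT P hP
  have h1 := one_lt_absNorm P
  rw [hf] at h1 ⊢
  exact Nat.le_self_pow (by rintro rfl; simp at h1) p

/-- A factor at a prime above `p` at most doubles the bound; the other factors do not affect the
values at powers of `p`. -/
theorem norm_prod_eulerFactor_apply_pow_le {p : ℕ} (hp : p.Prime)
    (T : Finset (HeightOneSpectrum (𝓞 K))) (k : ℕ) :
    ‖(∏ P ∈ T, eulerFactor K P) (p ^ k)‖ ≤
      2 ^ (T.filter fun P ↦ ∃ f, absNorm P.asIdeal = p ^ f).card := by
  induction T using Finset.induction_on generalizing k with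
  | empty =>
    simp [one_apply]
    split_ifs <;> simp
  | insert P T hP ih =>
    rw [Finset.prod_insert hP, eulerFactor_mul_apply P _ (pow_ne_zero _ hp.ne_zero)]
    split_ifs with hd
    · obtain ⟨f, -, hf⟩ := (Nat.dvd_prime_pow hp).mp hd
      rw [Finset.filter_insert, if_pos ⟨f, hf⟩, Finset.card_insert_of_notMem (by simp [hP])]
      obtain ⟨j, -, hj⟩ := (Nat.dvd_prime_pow hp).mp (Nat.div_dvd_of_dvd hd)
      rw [hj]
      refine (norm_sub_le _ _).trans ?_
      rw [pow_succ, mul_two]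
      exact add_le_add (ih k) (ih j)
    · rw [sub_zero]
      refine (ih k).trans (pow_le_pow_right₀ one_le_two (Finset.card_le_card ?_))
      exact Finset.filter_subset_filter _ (Finset.subset_insert _ _)

theorem norm_idealMoebius_apply_pow_le {p : ℕ} (hp : p.Prime) (k : ℕ) :
    ‖idealMoebius K (p ^ k)‖ ≤ 2 ^ Module.finrank ℚ K := by
  obtain ⟨T, hT⟩ := (eventually_prod_eulerFactor_apply (K := K) (p ^ k)).exists
  rw [← hT]
  refine (norm_prod_eulerFactor_apply_pow_le hp T k).trans (pow_le_pow_right₀ one_le_two ?_)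
  exact card_le_finrank_of_absNorm_eq_pow hp _ (by simp)

/-- The sum is the product of the `1 - x ^ f` over the primes of norm `p ^ f` in `T`, and `|x ^ f| <
1`. -/
theorem exists_hasSum_prod_eulerFactor_apply_pow {p : ℕ} (hp : p.Prime)
    (T : Finset (HeightOneSpectrum (𝓞 K))) {x : ℂ} (hx : ‖x‖ < 1) :
    ∃ L ≠ 0, HasSum (fun k ↦ (∏ P ∈ T, eulerFactor K P) (p ^ k) * x ^ k) L := by
  induction T using Finset.induction_on with
  | empty =>
    refine ⟨1, one_ne_zero, ?_⟩
    convert hasSum_ite_eq (0 : ℕ) (1 : ℂ) using 2 with k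
    rw [Finset.prod_empty, one_apply]
    rcases eq_or_ne k 0 with rfl | hk
    · simp
    · simp [hk, hp.ne_one]
  | insert P T hP ih =>
    obtain ⟨L, hL0, hL⟩ := ih
    simp_rw [Finset.prod_insert hP, eulerFactor_mul_apply P _ (pow_ne_zero _ hp.ne_zero)]
    by_cases hPf : ∃ f, absNorm P.asIdeal = p ^ f
    · obtain ⟨f, hf⟩ := hPf
      have hf0 : f ≠ 0 := by
        rintro rfl
        have := one_lt_absNorm P
        simp [hf] at this
      have hxf : ‖x ^ f‖ < 1 := by rw [norm_pow]; exact pow_lt_one₀ (norm_nonneg _) hx hf0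
      refine ⟨(1 - x ^ f) * L, mul_ne_zero (fun h ↦ ?_) hL0, ?_⟩
      · rw [← sub_eq_zero.mp h] at hxf; simp at hxf
      · rw [sub_mul, one_mul]
        simp_rw [sub_mul]
        refine hL.sub ?_
        refine ((add_left_injective f).hasSum_iff ?_).mp ?_
        · intro k hk
          rw [if_neg, zero_mul]
          rw [hf, Nat.pow_dvd_pow_iff_le_right hp.one_lt]
          exact fun h ↦ hk ⟨k - f, Nat.sub_add_cancel h⟩
        · refine Eq.mpr ?_ (hL.mul_left (x ^ f))
          congr 1
          funext k
          rw [Function.comp_apply]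
          rw [if_pos (by rw [hf]; exact pow_dvd_pow p (Nat.le_add_left _ _)), hf, pow_add,
            Nat.mul_div_cancel _ (pow_pos hp.pos f)]
          ring
    · refine ⟨L, hL0, ?_⟩
      convert hL using 3 with k
      rw [if_neg, sub_zero]
      intro h
      obtain ⟨f, -, hf⟩ := (Nat.dvd_prime_pow hp).mp h
      exact hPf ⟨f, hf⟩

theorem prod_eulerFactor_apply_pow_of_subset {p : ℕ} (hp : p.Prime)
    {T U : Finset (HeightOneSpectrum (𝓞 K))} (hTU : T ⊆ U)
    (h : ∀ P : HeightOneSpectrum (𝓞 K), (∃ f, absNorm P.asIdeal = p ^ f) → P ∈ T) (k : ℕ) :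
    (∏ P ∈ U, eulerFactor K P) (p ^ k) = (∏ P ∈ T, eulerFactor K P) (p ^ k) := by
  rw [← Finset.prod_sdiff hTU]
  have hd : ∀ P ∈ U \ T, ¬ absNorm P.asIdeal ∣ p ^ k := by
    intro P hP hd
    obtain ⟨f, -, hf⟩ := (Nat.dvd_prime_pow hp).mp hd
    exact (Finset.mem_sdiff.mp hP).2 (h P ⟨f, hf⟩)
  generalize U \ T = V at hd
  induction V using Finset.induction_on with
  | empty => simp
  | insert P V hP ih =>
    rw [Finset.prod_insert hP, mul_assoc, eulerFactor_mul_apply P _ (pow_ne_zero _ hp.ne_zero),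
      if_neg (hd P (Finset.mem_insert_self _ _)), sub_zero]
    exact ih fun Q hQ ↦ hd Q (Finset.mem_insert_of_mem hQ)

theorem exists_hasSum_idealMoebius_apply_pow {p : ℕ} (hp : p.Prime) {x : ℂ} (hx : ‖x‖ < 1) :
    ∃ L ≠ 0, HasSum (fun k ↦ idealMoebius K (p ^ k) * x ^ k) L := by
  have hfin : {P : HeightOneSpectrum (𝓞 K) | ∃ f, absNorm P.asIdeal = p ^ f}.Finite := by
    by_contra h
    obtain ⟨T, hT, hc⟩ := Set.Infinite.exists_subset_card_eq h (Module.finrank ℚ K + 1)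
    have := card_le_finrank_of_absNorm_eq_pow hp T fun P hP ↦ hT hP
    omega
  obtain ⟨L, hL0, hL⟩ := exists_hasSum_prod_eulerFactor_apply_pow hp hfin.toFinset hx
  refine ⟨L, hL0, ?_⟩
  convert hL using 3 with k
  obtain ⟨U, hU, hTU⟩ := ((eventually_prod_eulerFactor_apply (K := K) (p ^ k)).and
    (eventually_ge_atTop hfin.toFinset)).exists
  rw [← hU]
  exact prod_eulerFactor_apply_pow_of_subset hp hTU (fun P hP ↦ hfin.mem_toFinset.mpr hP) k

end NumberField

end

/-! ### Convergence and nonvanishing of multiplicative Dirichlet series. -/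

section

open Filter

/-- Every `0 < n < N` has only prime factors below `N`, so the partial sums are bounded by finite
Euler products, and `1 + x ≤ exp x` bounds these. The term `f 0` lies outside the product. -/
theorem summable_of_multiplicative_of_nonneg {f : ℕ → ℝ} (hf0 : ∀ n, 0 ≤ f n) (h1 : f 1 = 1)
    (hmul : ∀ {m n : ℕ}, m.Coprime n → f (m * n) = f m * f n)
    (hp : ∀ {p : ℕ}, p.Prime → Summable fun k ↦ f (p ^ k))
    (hs : Summable fun p : Nat.Primes ↦ ∑' k, f ((p : ℕ) ^ (k + 1))) : Summable f := by
  refine summable_of_sum_range_le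
    (c := f 0 + Real.exp (∑' p : Nat.Primes, ∑' k, f ((p : ℕ) ^ (k + 1)))) hf0 fun N ↦ ?_
  have hS := (EulerProduct.summable_and_hasSum_smoothNumbers_prod_primesBelow_tsum h1 hmul
    (fun hpp ↦ by simpa [abs_of_nonneg (hf0 _)] using hp hpp) N).2
  have h2 : ∑ n ∈ Finset.range N, f n ≤ f 0 + ∏ p ∈ N.primesBelow, ∑' n : ℕ, f (p ^ n) := by
    replace hS : HasSum ((N.smoothNumbers).indicator f)
        (∏ p ∈ N.primesBelow, ∑' n : ℕ, f (p ^ n)) :=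
      hasSum_subtype_iff_indicator.mp hS
    have h3 := sum_le_hasSum ((Finset.range N).filter (· ≠ 0))
      (fun n _ ↦ Set.indicator_nonneg (fun n _ ↦ hf0 n) n) hS
    have h4 : ∑ n ∈ (Finset.range N).filter (· ≠ 0), (N.smoothNumbers).indicator f n =
        ∑ n ∈ (Finset.range N).filter (· ≠ 0), f n := by
      refine Finset.sum_congr rfl fun n hn ↦ Set.indicator_of_mem ?_ f
      rw [Finset.mem_filter, Finset.mem_range] at hn
      exact Nat.mem_smoothNumbers_of_lt (Nat.pos_of_ne_zero hn.2) hn.1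
    rw [h4] at h3
    rw [← Finset.sum_filter_add_sum_filter_not (Finset.range N) (· ≠ 0), add_comm]
    refine add_le_add ?_ h3
    have : (Finset.range N).filter (fun n ↦ ¬ n ≠ 0) ⊆ {0} := by
      intro n hn
      simpa using (Finset.mem_filter.mp hn).2
    simpa using Finset.sum_le_sum_of_subset_of_nonneg this fun n _ _ ↦ hf0 n
  refine h2.trans (add_le_add_right ?_ _)
  have h5 : ∀ p ∈ N.primesBelow, ∑' n : ℕ, f (p ^ n) ≤ Real.exp (∑' k, f (p ^ (k + 1))) := by
    intro p hpN
    rw [(hp (Nat.prime_of_mem_primesBelow hpN)).tsum_eq_zero_add, pow_zero, h1, add_comm]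
    exact Real.add_one_le_exp _
  refine (Finset.prod_le_prod (fun p _ ↦ tsum_nonneg fun _ ↦ hf0 _) h5).trans ?_
  rw [← Real.exp_sum, Real.exp_le_exp]
  have h6 : ∑ p ∈ N.primesBelow, ∑' k, f (p ^ (k + 1)) =
      ∑ p ∈ N.primesBelow.subtype Nat.Prime, ∑' k, f ((p : ℕ) ^ (k + 1)) := by
    rw [Finset.sum_subtype_eq_sum_filter (p := Nat.Prime) (fun p : ℕ ↦ ∑' k, f (p ^ (k + 1))),
      Finset.filter_true_of_mem]
    exact fun p hp ↦ Nat.prime_of_mem_primesBelow hp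
  rw [h6]
  exact Summable.sum_le_tsum (ι := Nat.Primes) _ (fun p _ ↦ tsum_nonneg fun _ ↦ hf0 _) hs

namespace ArithmeticFunction

variable {g : ArithmeticFunction ℂ}

theorem LSeries.term_mul_of_coprime (hg : g.IsMultiplicative) (s : ℂ) {m n : ℕ} (h : m.Coprime n) :
    LSeries.term g s (m * n) = LSeries.term g s m * LSeries.term g s n := by
  rcases eq_or_ne m 0 with rfl | hm
  · simp
  rcases eq_or_ne n 0 with rfl | hn
  · simp
  rw [LSeries.term_of_ne_zero hm, LSeries.term_of_ne_zero hn,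
    LSeries.term_of_ne_zero (mul_ne_zero hm hn), hg.2 h, Nat.cast_mul,
    Complex.natCast_mul_natCast_cpow, mul_div_mul_comm]

theorem norm_term_prime_pow {p : ℕ} (hp : p.Prime) (σ : ℝ) (k : ℕ) :
    ‖LSeries.term g σ (p ^ k)‖ = ‖g (p ^ k)‖ * ((p : ℝ) ^ (-σ)) ^ k := by
  rw [LSeries.norm_term_eq, if_neg (pow_ne_zero _ hp.ne_zero), Complex.ofReal_re, Nat.cast_pow,
    Real.rpow_neg (Nat.cast_nonneg p), inv_pow, ← Real.rpow_natCast (n := k) (x := (p : ℝ)),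
    ← Real.rpow_natCast (n := k) (x := (p : ℝ) ^ σ), ← Real.rpow_mul (Nat.cast_nonneg p),
    ← Real.rpow_mul (Nat.cast_nonneg p), mul_comm (k : ℝ), div_eq_mul_inv]

theorem summable_norm_term_prime_pow {p : ℕ} (hp : p.Prime) {σ : ℝ} (hσ : 0 < σ) {C : ℝ}
    (h : ∀ k : ℕ, ‖g (p ^ k)‖ ≤ C * (k + 1)) : Summable fun k ↦ ‖LSeries.term g σ (p ^ k)‖ := by
  have hx : ‖(p : ℝ) ^ (-σ)‖ < 1 := by
    rw [Real.norm_of_nonneg (by positivity)]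
    exact Real.rpow_lt_one_of_one_lt_of_neg (by exact_mod_cast hp.one_lt) (by linarith)
  have h1 := summable_pow_mul_geometric_of_norm_lt_one 1 hx
  have h2 := summable_geometric_of_norm_lt_one hx
  refine Summable.of_nonneg_of_le (fun _ ↦ norm_nonneg _) (fun k ↦ ?_) ((h1.add h2).mul_left C)
  rw [norm_term_prime_pow hp]
  calc _ ≤ C * (k + 1) * ((p : ℝ) ^ (-σ)) ^ k := by gcongr; exact h k
    _ = _ := by ring

/-- As `g p = 0`, the sum starts at `p ^ 2` and a factor `p ^ (-2σ)` comes out. Replacing `p` by `2`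
in the rest makes the constant uniform; for `σ > 1/2` the sum over `p` converges. -/
theorem tsum_norm_term_prime_pow_succ_le {p : ℕ} (hp : p.Prime) {C : ℝ}
    (hC : ∀ k : ℕ, ‖g (p ^ k)‖ ≤ C * (k + 1)) (h0 : g p = 0) {σ : ℝ} (hσ : 0 < σ) :
    ∑' k, ‖LSeries.term g σ (p ^ (k + 1))‖ ≤
      C * ((p : ℝ) ^ (-(2 * σ)) * ∑' k : ℕ, ((k : ℝ) + 3) * ((2 : ℝ) ^ (-σ)) ^ k) := by
  have hy : ‖(2 : ℝ) ^ (-σ)‖ < 1 := by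
    rw [Real.norm_of_nonneg (by positivity)]
    exact Real.rpow_lt_one_of_one_lt_of_neg one_lt_two (by linarith)
  have hA : Summable fun k : ℕ ↦ ((k : ℝ) + 3) * ((2 : ℝ) ^ (-σ)) ^ k := by
    have h1 := summable_pow_mul_geometric_of_norm_lt_one 1 hy
    have h2 := (summable_geometric_of_norm_lt_one hy).mul_left 3
    refine (h1.add h2).congr fun k ↦ ?_
    ring
  have hC0 : 0 ≤ C := by simpa using (norm_nonneg _).trans (hC 0)
  have hsm : Summable fun k ↦ ‖LSeries.term g σ (p ^ k)‖ :=
    summable_norm_term_prime_pow hp hσ hC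
  have hle : ∀ k : ℕ, ‖LSeries.term g σ (p ^ (k + 1 + 1))‖ ≤
      C * ((p : ℝ) ^ (-(2 * σ)) * (((k : ℝ) + 3) * ((2 : ℝ) ^ (-σ)) ^ k)) := by
    intro k
    have hp2 : (2 : ℝ) ≤ p := by exact_mod_cast hp.two_le
    have h3 : (p : ℝ) ^ (-(2 * σ)) = ((p : ℝ) ^ (-σ)) ^ 2 := by
      rw [← Real.rpow_natCast, ← Real.rpow_mul (by positivity)]
      congr 1; push_cast; ring
    rw [norm_term_prime_pow hp, h3]
    calc _ ≤ C * ((k + 1 + 1 : ℕ) + 1) * ((p : ℝ) ^ (-σ)) ^ (k + 1 + 1) := by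
          gcongr; exact hC _
      _ = C * (((p : ℝ) ^ (-σ)) ^ 2 * (((k : ℝ) + 3) * ((p : ℝ) ^ (-σ)) ^ k)) := by
          push_cast; ring
      _ ≤ _ := by
          gcongr C * (_ * (_ * ?_ ^ k))
          exact Real.rpow_le_rpow_of_nonpos two_pos hp2 (by linarith)
  have hz : ‖LSeries.term g σ (p ^ (0 + 1))‖ = 0 := by
    rw [zero_add, norm_term_prime_pow hp, pow_one, h0]; simp
  have hsm1 : Summable fun k ↦ ‖LSeries.term g σ (p ^ (k + 1))‖ :=
    (summable_nat_add_iff (f := fun k ↦ ‖LSeries.term g σ (p ^ k)‖) 1).mpr hsm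
  have hsm2 : Summable fun k ↦ ‖LSeries.term g σ (p ^ (k + 1 + 1))‖ :=
    (summable_nat_add_iff (f := fun k ↦ ‖LSeries.term g σ (p ^ (k + 1))‖) 1).mpr hsm1
  rw [hsm1.tsum_eq_zero_add, hz, zero_add, ← tsum_mul_left, ← tsum_mul_left]
  exact hsm2.tsum_le_tsum hle ((hA.mul_left _).mul_left _)

theorem summable_tsum_norm_term_prime_pow {S : Set ℕ} (hS : S.Finite) {C : ℝ}
    (hC : ∀ p, p.Prime → p ∉ S → ∀ k : ℕ, ‖g (p ^ k)‖ ≤ C * (k + 1))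
    (h0 : ∀ p, p.Prime → p ∉ S → g p = 0) {σ : ℝ} (hσ : 1 / 2 < σ) :
    Summable fun p : Nat.Primes ↦ ∑' k, ‖LSeries.term g σ ((p : ℕ) ^ (k + 1))‖ := by
  have hsum : Summable fun p : Nat.Primes ↦ C * (((p : ℕ) : ℝ) ^ (-(2 * σ)) *
      ∑' k : ℕ, ((k : ℝ) + 3) * ((2 : ℝ) ^ (-σ)) ^ k) :=
    ((Nat.Primes.summable_rpow.mpr (by linarith)).mul_right _).mul_left _
  refine Summable.of_norm_bounded_eventually hsum ?_
  have hfin : {p : Nat.Primes | (p : ℕ) ∈ S}.Finite := hS.preimage (fun _ _ _ _ h ↦ Subtype.ext h)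
  filter_upwards [hfin.compl_mem_cofinite] with p hpS
  rw [Real.norm_of_nonneg (tsum_nonneg fun _ ↦ norm_nonneg _)]
  exact tsum_norm_term_prime_pow_succ_le p.2 (hC p p.2 hpS) (h0 p p.2 hpS) (by linarith)

theorem LSeriesSummable_of_prime_pow (hg : g.IsMultiplicative) {S : Set ℕ} (hS : S.Finite) {C : ℝ}
    (hC : ∀ p, p.Prime → p ∉ S → ∀ k : ℕ, ‖g (p ^ k)‖ ≤ C * (k + 1))
    (hCp : ∀ p, p.Prime → ∃ C : ℝ, ∀ k : ℕ, ‖g (p ^ k)‖ ≤ C * (k + 1))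
    (h0 : ∀ p, p.Prime → p ∉ S → g p = 0) {σ : ℝ} (hσ : 1 / 2 < σ) : LSeriesSummable g σ := by
  refine Summable.of_norm ?_
  refine summable_of_multiplicative_of_nonneg (fun _ ↦ norm_nonneg _) ?_ (fun h ↦ ?_)
    (fun {p} hp ↦ ?_) (summable_tsum_norm_term_prime_pow hS hC h0 hσ)
  · rw [LSeries.term_of_ne_zero one_ne_zero, hg.1]; simp
  · rw [LSeries.term_mul_of_coprime hg _ h, norm_mul]
  · obtain ⟨C', hC'⟩ := hCp p hp
    exact summable_norm_term_prime_pow hp (by linarith) hC'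

theorem LSeries_ne_zero_of_prime_pow (hg : g.IsMultiplicative) {S : Set ℕ} (hS : S.Finite) {C : ℝ}
    (hC : ∀ p, p.Prime → p ∉ S → ∀ k : ℕ, ‖g (p ^ k)‖ ≤ C * (k + 1))
    (hCp : ∀ p, p.Prime → ∃ C : ℝ, ∀ k : ℕ, ‖g (p ^ k)‖ ≤ C * (k + 1))
    (h0 : ∀ p, p.Prime → p ∉ S → g p = 0) {σ : ℝ} (hσ : 1 / 2 < σ)
    (hne : ∀ p, p.Prime → ∑' k, LSeries.term g σ (p ^ k) ≠ 0) : LSeries g σ ≠ 0 := by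
  have hsum := (LSeriesSummable_of_prime_pow hg hS hC hCp h0 hσ).norm
  have h1 : LSeries.term g σ 1 = 1 := by
    rw [LSeries.term_of_ne_zero one_ne_zero, hg.1]; simp
  have hprod := EulerProduct.eulerProduct_hasProd h1
    (fun h ↦ LSeries.term_mul_of_coprime hg _ h) hsum (LSeries.term_zero ..)
  have hloc : ∀ p : Nat.Primes, ∑' k, LSeries.term g σ ((p : ℕ) ^ k) =
      1 + ∑' k, LSeries.term g σ ((p : ℕ) ^ (k + 1)) := by
    intro p
    have : Summable fun k ↦ LSeries.term g σ ((p : ℕ) ^ k) :=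
      hsum.of_norm.comp_injective (Nat.pow_right_injective p.2.one_lt)
    rw [this.tsum_eq_zero_add, pow_zero, h1]
  rw [LSeries, ← hprod.tprod_eq]
  simp_rw [hloc]
  refine tprod_one_add_ne_zero_of_summable (fun p ↦ ?_) ?_
  · rw [← hloc]; exact hne p p.2
  · refine Summable.of_nonneg_of_le (fun _ ↦ norm_nonneg _) (fun p ↦ ?_)
      (summable_tsum_norm_term_prime_pow hS hC h0 hσ)
    refine norm_tsum_le_tsum_norm ?_
    exact hsum.comp_injective (i := fun k ↦ (p : ℕ) ^ (k + 1))
      ((Nat.pow_right_injective p.2.one_lt).comp (add_left_injective 1))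

end ArithmeticFunction

end

/-! ### Roots of a polynomial modulo prime powers. -/

section

open Polynomial

theorem polyRho_eq_card (F : ℤ[X]) {n : ℕ} (hn : n ≠ 0) :
    polyRho F n = Nat.card {x : ZMod n // aeval x F = 0} := by
  have : NeZero n := ⟨hn⟩
  have key : ∀ k : ℕ, aeval (k : ZMod n) F = 0 ↔ (n : ℤ) ∣ F.eval (k : ℤ) := by
    intro k
    rw [← ZMod.intCast_zmod_eq_zero_iff_dvd, ← eq_intCast (Int.castRingHom (ZMod n)),
      ← eval₂_at_apply, aeval_def]
    simp
  rw [polyRho, ← Fintype.card_coe, ← Nat.card_eq_fintype_card]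
  refine Nat.card_congr (Equiv.ofBijective
    (fun k ↦ ⟨((k : ℕ) : ZMod n), (key _).mpr (Finset.mem_filter.mp k.2).2⟩) ⟨?_, ?_⟩)
  · rintro ⟨a, ha⟩ ⟨b, hb⟩ hab
    rw [Finset.mem_filter, Finset.mem_range] at ha hb
    have h := congrArg ZMod.val (Subtype.ext_iff.mp hab)
    simp only [ZMod.val_natCast, Nat.mod_eq_of_lt ha.1, Nat.mod_eq_of_lt hb.1] at h
    exact Subtype.ext h
  · rintro ⟨x, hx⟩
    refine ⟨⟨x.val, Finset.mem_filter.mpr ⟨Finset.mem_range.mpr x.val_lt, ?_⟩⟩, ?_⟩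
    · rw [← key]; simpa using hx
    · simp

theorem polyRho_zero (F : ℤ[X]) : polyRho F 0 = 0 := by simp [polyRho]

theorem polyRho_one (F : ℤ[X]) : polyRho F 1 = 1 := by simp [polyRho]

theorem polyRho_le (F : ℤ[X]) (n : ℕ) : polyRho F n ≤ n :=
  (Finset.card_filter_le _ _).trans (Finset.card_range n).le

theorem polyRho_mul_of_coprime (F : ℤ[X]) {m n : ℕ} (h : m.Coprime n) :
    polyRho F (m * n) = polyRho F m * polyRho F n := by
  rcases eq_or_ne m 0 with rfl | hm
  · simp [polyRho_zero]
  rcases eq_or_ne n 0 with rfl | hn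
  · simp [polyRho_zero]
  rw [polyRho_eq_card F hm, polyRho_eq_card F hn, polyRho_eq_card F (mul_ne_zero hm hn),
    ← Nat.card_prod]
  let e := ZMod.chineseRemainder h
  have key : ∀ x, aeval x F = 0 ↔ aeval (e x).1 F = 0 ∧ aeval (e x).2 F = 0 := by
    intro x
    rw [← map_eq_zero_iff e e.injective, ← Prod.mk_eq_zero, ← aeval_prod_apply]
    have : e (aeval x F) = aeval (e x) F := by
      rw [aeval_def, aeval_def, ← RingEquiv.coe_toRingHom, hom_eval₂]
      congr 1
      exact RingHom.ext_int _ _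
    rw [this]
  refine Nat.card_congr (Equiv.trans (e.toEquiv.subtypeEquiv
    (q := fun y ↦ aeval y.1 F = 0 ∧ aeval y.2 F = 0) key)
    (Equiv.subtypeProdEquivProd (p := fun y : ZMod m ↦ aeval y F = 0)
      (q := fun y : ZMod n ↦ aeval y F = 0)))

theorem Int.prime_pow_dvd_of_dvd_mul {p : ℕ} (hp : p.Prime) {a u : ℤ} {k v : ℕ}
    (h : (p : ℤ) ^ k ∣ a * u) (hu : ¬ (p : ℤ) ^ (v + 1) ∣ u) : (p : ℤ) ^ (k - v) ∣ a := by
  have hp' : Prime (p : ℤ) := Nat.prime_iff_prime_int.mp hp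
  rw [pow_dvd_iff_le_emultiplicity] at h hu ⊢
  rw [emultiplicity_mul hp', ] at h
  rw [not_le, Nat.cast_add, Nat.cast_one] at hu
  generalize emultiplicity (p : ℤ) a = x at *
  generalize emultiplicity (p : ℤ) u = y at *
  cases x with
  | top => exact le_top
  | coe x =>
    cases y with
    | top => simp at hu
    | coe y =>
      norm_cast at *
      omega

/-- For roots `x ≡ y` modulo `p ^ (v + 1)`, the difference `F y - F x` is `(y - x) * (F' x + w * (y
- x))`. By the Bézout identity `p ^ (v + 1)` does not divide the second factor, so `p ^ (k - v)`
divides `y - x`. A root is thus determined by its residue modulo `p ^ (v + 1)` and its quotient by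
`p ^ (k - v)`, which takes at most `p ^ v` values. -/
theorem polyRho_prime_pow_le {F U V : ℤ[X]} {D : ℤ} (hD : U * F + V * derivative F = C D) {p : ℕ}
    (hp : p.Prime) {v k : ℕ} (hv : ¬ (p : ℤ) ^ (v + 1) ∣ D) (hk : v + 1 ≤ k) :
    polyRho F (p ^ k) ≤ polyRho F (p ^ (v + 1)) * p ^ v := by
  have hpk : p ^ k = p ^ (k - v) * p ^ v := by rw [← pow_add]; congr 1; omega
  nth_rewrite 1 [← Finset.card_range (p ^ v)]
  rw [polyRho, polyRho, ← Finset.card_product]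
  refine Finset.card_le_card_of_injOn (fun x ↦ (x % p ^ (v + 1), x / p ^ (k - v))) ?_ ?_
  · intro x hx
    rw [Finset.mem_coe, Finset.mem_filter, Finset.mem_range] at hx
    rw [Finset.mem_coe, Finset.mem_product, Finset.mem_filter, Finset.mem_range, Finset.mem_range]
    refine ⟨⟨Nat.mod_lt _ (pow_pos hp.pos _), ?_⟩, ?_⟩
    · have h1 : ((p ^ (v + 1) : ℕ) : ℤ) ∣ (x : ℤ) - (x % p ^ (v + 1) : ℕ) := by
        rw [Int.natCast_mod]; exact Int.dvd_self_sub_emod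
      have h2 : ((p ^ (v + 1) : ℕ) : ℤ) ∣ F.eval (x : ℤ) :=
        (Int.natCast_dvd_natCast.mpr (pow_dvd_pow p hk)).trans hx.2
      exact (dvd_sub_right h2).mp (h1.trans (sub_dvd_eval_sub _ _ F))
    · rw [Nat.div_lt_iff_lt_mul (pow_pos hp.pos _), mul_comm, ← hpk]
      exact hx.1
  · intro x hx y hy hxy
    rw [Finset.mem_coe, Finset.mem_filter, Finset.mem_range] at hx hy
    obtain ⟨h1, h2⟩ := Prod.mk.inj hxy
    push_cast at hx hy
    obtain ⟨w, hw⟩ := binomExpansion F (x : ℤ) ((y : ℤ) - x)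
    rw [add_sub_cancel] at hw
    have hyx : (p : ℤ) ^ (v + 1) ∣ (y : ℤ) - x := by
      exact_mod_cast (Nat.modEq_iff_dvd.mp (show x ≡ y [MOD p ^ (v + 1)] from h1))
    have h3 : (p : ℤ) ^ k ∣ ((y : ℤ) - x) * (F.derivative.eval (x : ℤ) + w * ((y : ℤ) - x)) := by
      have := dvd_sub hy.2 hx.2
      rwa [hw, show F.eval (x : ℤ) + F.derivative.eval (x : ℤ) * ((y : ℤ) - x) +
        w * ((y : ℤ) - x) ^ 2 - F.eval (x : ℤ) =
        ((y : ℤ) - x) * (F.derivative.eval (x : ℤ) + w * ((y : ℤ) - x)) by ring] at this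
    have h4 : ¬ (p : ℤ) ^ (v + 1) ∣ F.derivative.eval (x : ℤ) + w * ((y : ℤ) - x) := by
      intro h
      have h5 := (dvd_add_left (hyx.mul_left w)).mp h
      apply hv
      have h6 := congrArg (eval (x : ℤ)) hD
      rw [eval_add, eval_mul, eval_mul, eval_C] at h6
      rw [← h6]
      exact dvd_add (((pow_dvd_pow _ hk).trans hx.2).mul_left _) (h5.mul_left _)
    have h5 := Int.prime_pow_dvd_of_dvd_mul hp h3 h4
    have h6 : x ≡ y [MOD p ^ (k - v)] := Nat.modEq_iff_dvd.mpr (by exact_mod_cast h5)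
    rw [← Nat.div_add_mod x (p ^ (k - v)), ← Nat.div_add_mod y (p ^ (k - v)), h2, h6]

theorem exists_polyRho_prime_pow_le {F U V : ℤ[X]} {D : ℤ} (hD : U * F + V * derivative F = C D)
    (hD0 : D ≠ 0) {p : ℕ} (hp : p.Prime) : ∃ B : ℕ, ∀ k, polyRho F (p ^ k) ≤ B := by
  -- Any `v` with `p ^ (v + 1)` not dividing `D` would do; `|D| < p ^ (|D| + 1)` spares a valuation.
  set v := D.natAbs
  have hv : ¬ (p : ℤ) ^ (v + 1) ∣ D := by
    intro h
    rw [← Int.natAbs_dvd_natAbs, Int.natAbs_pow, Int.natAbs_natCast] at h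
    have h1 := Nat.le_of_dvd (Int.natAbs_pos.mpr hD0) h
    have h2 := Nat.lt_pow_self (n := v + 1) hp.one_lt
    omega
  refine ⟨p ^ v + polyRho F (p ^ (v + 1)) * p ^ v, fun k ↦ ?_⟩
  rcases le_or_gt (v + 1) k with hk | hk
  · exact (polyRho_prime_pow_le hD hp hv hk).trans (Nat.le_add_left _ _)
  · exact (polyRho_le _ _).trans ((Nat.pow_le_pow_right hp.pos (by omega)).trans
      (Nat.le_add_right _ _))

/-- The case `v = 0` above: each root modulo `p` lifts in at most one way. `F` is nonzero modulo
`p`, since otherwise `p` would divide `D`. The extra `1` allows for `k = 0`. -/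
theorem polyRho_prime_pow_le_natDegree {F U V : ℤ[X]} {D : ℤ}
    (hD : U * F + V * derivative F = C D) {p : ℕ} (hp : p.Prime) (hpD : ¬ (p : ℤ) ∣ D) (k : ℕ) :
    polyRho F (p ^ k) ≤ F.natDegree + 1 := by
  rcases Nat.eq_zero_or_pos k with rfl | hk
  · rw [pow_zero, polyRho_one]; omega
  have h1 := polyRho_prime_pow_le hD hp (v := 0) (k := k) (by simpa using hpD) hk
  rw [zero_add, pow_one, pow_zero, mul_one] at h1
  refine h1.trans ?_
  have := Fact.mk hp
  rw [polyRho_eq_card F hp.ne_zero]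
  set f := F.map (Int.castRingHom (ZMod p)) with hf
  have hf0 : f ≠ 0 := by
    intro h
    have h2 := congrArg (Polynomial.map (Int.castRingHom (ZMod p))) hD
    rw [Polynomial.map_add, Polynomial.map_mul, Polynomial.map_mul, ← derivative_map, ← hf, h,
      map_C] at h2
    simp only [mul_zero, derivative_zero, add_zero] at h2
    rw [eq_comm, C_eq_zero, eq_intCast, ZMod.intCast_zmod_eq_zero_iff_dvd] at h2
    exact hpD h2
  have h3 : Nat.card {x : ZMod p // aeval x F = 0} ≤ f.roots.toFinset.card := by
    rw [← Fintype.card_coe, ← Nat.card_eq_fintype_card]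
    refine Nat.card_le_card_of_injective (fun x ↦ ⟨x.1, ?_⟩) ?_
    · rw [Multiset.mem_toFinset, mem_roots hf0, IsRoot.def, hf, eval_map]
      exact x.2
    · intro x y hxy
      exact Subtype.ext (congrArg (fun z : f.roots.toFinset ↦ z.1) hxy)
  exact h3.trans ((Multiset.toFinset_card_le _).trans ((card_roots' f).trans
    ((natDegree_map_le).trans (Nat.le_succ _))))

theorem Polynomial.exists_int_map_eq_smul (q : ℚ[X]) :
    ∃ (N : ℤ) (h : ℤ[X]), N ≠ 0 ∧ h.map (Int.castRingHom ℚ) = C (N : ℚ) * q := by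
  obtain ⟨b, hb, h⟩ := IsLocalization.integerNormalization_spec (nonZeroDivisors ℤ) q
  refine ⟨b, IsLocalization.integerNormalization (nonZeroDivisors ℤ) q,
    nonZeroDivisors.ne_zero hb, ?_⟩
  rw [algebraMap_int_eq] at h
  rw [h, ← smul_eq_C_mul]
  ext i
  simp

theorem Polynomial.exists_mul_add_mul_derivative_eq_C {F : ℤ[X]}
    (hF : Irreducible (F.map (Int.castRingHom ℚ))) :
    ∃ (U V : ℤ[X]) (D : ℤ), D ≠ 0 ∧ U * F + V * derivative F = C D := by
  obtain ⟨a, b, hab⟩ := hF.separable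
  obtain ⟨N, u, hN, hu⟩ := exists_int_map_eq_smul a
  obtain ⟨M, w, hM, hw⟩ := exists_int_map_eq_smul b
  refine ⟨C M * u, C N * w, N * M, mul_ne_zero hN hM, ?_⟩
  apply map_injective (Int.castRingHom ℚ) Int.cast_injective
  simp only [Polynomial.map_add, Polynomial.map_mul, map_C, hu, hw, ← derivative_map,
    eq_intCast (Int.castRingHom ℚ), C_mul]
  linear_combination (C (N : ℚ) * C (M : ℚ)) * hab

end

/-! ### Roots modulo `p` and ideals of norm `p`. -/

section

open Polynomial NumberField

/-- A quotient of order `p` is `ZMod p`, and a homomorphism to `ZMod p` is determined by its kernel,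
because every element is congruent to an integer modulo that kernel. -/
theorem Ideal.card_absNorm_eq_prime {A : Type*} [CommRing A] [IsDedekindDomain A]
    [Module.Free ℤ A] [Module.Finite ℤ A] {p : ℕ} (hp : p.Prime) :
    Nat.card {I : Ideal A // absNorm I = p} = Nat.card (A →+* ZMod p) := by
  have := Fact.mk hp
  have hker : ∀ φ : A →+* ZMod p, absNorm (RingHom.ker φ) = p := by
    intro φ
    rw [absNorm_apply, Submodule.cardQuot_apply]
    exact (Nat.card_congr (RingHom.quotientKerEquivOfSurjective
      (ZMod.ringHom_surjective φ)).toEquiv).trans (Nat.card_zmod p)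
  symm
  refine Nat.card_congr (Equiv.ofBijective (fun φ ↦ ⟨RingHom.ker φ, hker φ⟩) ⟨?_, ?_⟩)
  · intro φ ψ h
    replace h : RingHom.ker φ = RingHom.ker ψ := congrArg Subtype.val h
    ext x
    have h1 : x - ((φ x).val : A) ∈ RingHom.ker φ := by simp [RingHom.mem_ker]
    rw [h, RingHom.mem_ker, map_sub, map_natCast, ZMod.natCast_zmod_val, sub_eq_zero] at h1
    exact h1.symm
  · rintro ⟨I, hI⟩
    rw [absNorm_apply, Submodule.cardQuot_apply] at hI
    have : Finite (A ⧸ I) := Nat.finite_of_card_ne_zero (by rw [hI]; exact hp.ne_zero)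
    have := Fintype.ofFinite (A ⧸ I)
    let e := ZMod.ringEquivOfPrime (A ⧸ I) hp (by rw [← Nat.card_eq_fintype_card]; exact hI)
    refine ⟨(e.symm : A ⧸ I →+* ZMod p).comp (Ideal.Quotient.mk I), Subtype.ext ?_⟩
    ext x
    simp [RingHom.mem_ker, Ideal.Quotient.eq_zero_iff_mem]

variable {K : Type*} [Field K] [NumberField K] {θ : K}

theorem exists_aeval_eq_of_adjoin_eq_top (hK : IntermediateField.adjoin ℚ {θ} = ⊤) (x : K) :
    ∃ (N : ℤ) (h : ℤ[X]), N ≠ 0 ∧ aeval θ h = N * x := by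
  have hx : x ∈ IntermediateField.adjoin ℚ {θ} := by rw [hK]; trivial
  rw [← IntermediateField.mem_toSubalgebra,
    IntermediateField.adjoin_simple_toSubalgebra_of_isAlgebraic
    (Algebra.IsAlgebraic.isAlgebraic θ), Algebra.adjoin_singleton_eq_range_aeval] at hx
  obtain ⟨q, rfl⟩ := hx
  obtain ⟨N, h, hN, hh⟩ := exists_int_map_eq_smul q
  refine ⟨N, h, hN, ?_⟩
  have h1 := congrArg (aeval θ) hh
  rw [← algebraMap_int_eq, aeval_map_algebraMap, map_mul, aeval_C] at h1
  simpa using h1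

/-- A single `N` makes `N * θ` integral and puts `N * 𝓞 K` inside `ℤ[θ]`, so `θ` may stand in for a
generator of `𝓞 K` once `N` is invertible. -/
theorem exists_common_denominator (hK : IntermediateField.adjoin ℚ {θ} = ⊤) :
    ∃ N : ℤ, N ≠ 0 ∧ (∃ α : 𝓞 K, (α : K) = N * θ) ∧
      ∀ x : 𝓞 K, ∃ h : ℤ[X], aeval θ h = N * (x : K) := by
  obtain ⟨n, s, hs⟩ := Module.Finite.exists_fin (R := ℤ) (M := 𝓞 K)
  choose M q hM hq using fun i ↦ exists_aeval_eq_of_adjoin_eq_top hK (s i : K)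
  obtain ⟨y, hy0, hy⟩ := IsAlgebraic.exists_integral_multiple
    ((IsFractionRing.isAlgebraic_iff ℤ ℚ K).mpr (Algebra.IsAlgebraic.isAlgebraic θ))
  have key : ∀ x : 𝓞 K, ∃ h : ℤ[X], aeval θ h = (∏ i, M i : ℤ) * (x : K) := by
    intro x
    have hx : x ∈ Submodule.span ℤ (Set.range s) := by rw [hs]; trivial
    induction hx using Submodule.span_induction with
    | mem x hx =>
      obtain ⟨i, rfl⟩ := hx
      refine ⟨C (∏ j ∈ Finset.univ.erase i, M j) * q i, ?_⟩
      rw [map_mul, aeval_C, hq, ← Finset.mul_prod_erase _ _ (Finset.mem_univ i)]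
      simp
      ring
    | zero => exact ⟨0, by simp⟩
    | add x y _ _ hx hy =>
      obtain ⟨f, hf⟩ := hx
      obtain ⟨g, hg⟩ := hy
      exact ⟨f + g, by rw [map_add, hf, hg]; push_cast; ring⟩
    | smul a x _ hx =>
      obtain ⟨f, hf⟩ := hx
      refine ⟨C a * f, ?_⟩
      rw [map_mul, aeval_C, hf]
      simp
      ring
  refine ⟨y * ∏ i, M i, mul_ne_zero hy0 (Finset.prod_ne_zero_iff.mpr fun i _ ↦ hM i), ?_, ?_⟩
  · obtain ⟨β, hβ⟩ : ∃ β : 𝓞 K, (β : K) = y • θ := ⟨⟨y • θ, hy⟩, rfl⟩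
    refine ⟨((∏ i, M i : ℤ) : 𝓞 K) * β, ?_⟩
    simp [hβ]
    ring
  · intro x
    obtain ⟨h, hh⟩ := key x
    refine ⟨C y * h, ?_⟩
    rw [map_mul, aeval_C, hh]
    simp
    ring

/-- By Gauss's lemma the primitive part of `F` divides `h` over `ℤ`. The content must be nonzero in
`R`, so that a root of `F` is a root of its primitive part. -/
theorem aeval_eq_zero_of_aeval_eq_zero {F : ℤ[X]}
    (hF : Irreducible (F.map (Int.castRingHom ℚ))) (hθ : aeval θ F = 0) {h : ℤ[X]}
    (hh : aeval θ h = 0) {R : Type*} [CommRing R] [IsDomain R] {r : R} (hr : aeval r F = 0)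
    (hc : ((F.content : ℤ) : R) ≠ 0) : aeval r h = 0 := by
  have h1 : aeval r F.primPart = 0 := by
    rw [F.eq_C_content_mul_primPart, map_mul, aeval_C] at hr
    exact (mul_eq_zero.mp hr).resolve_left (by simpa using hc)
  have hFQ : F.map (Int.castRingHom ℚ) ∣ h.map (Int.castRingHom ℚ) := by
    have ha : ∀ f : ℤ[X], aeval θ (f.map (Int.castRingHom ℚ)) = aeval θ f := fun f ↦ by
      rw [← algebraMap_int_eq, aeval_map_algebraMap]
    have h2 : minpoly ℚ θ ∣ F.map (Int.castRingHom ℚ) := minpoly.dvd ℚ θ ((ha F).trans hθ)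
    have h3 := (minpoly.irreducible (Algebra.IsIntegral.isIntegral θ)).dvd_symm hF h2
    exact h3.trans (minpoly.dvd ℚ θ ((ha h).trans hh))
  have hd : F.primPart ∣ h :=
    (IsPrimitive.Int.dvd_iff_map_cast_dvd_map_cast _ _ F.isPrimitive_primPart).mpr
      ((map_dvd (mapRingHom (Int.castRingHom ℚ)) F.primPart_dvd).trans hFQ)
  obtain ⟨q, rfl⟩ := hd
  rw [map_mul, h1, zero_mul]

/-- Set `φ x = N⁻¹ * h(r)` whenever `h(θ) = N * x`; the preceding lemma makes this independent of
`h`. -/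
theorem exists_ringHom_of_aeval_eq_zero {F : ℤ[X]} (hF : Irreducible (F.map (Int.castRingHom ℚ)))
    (hθ : aeval θ F = 0) {N : ℤ} (hN : ∀ x : 𝓞 K, ∃ h : ℤ[X], aeval θ h = N * (x : K))
    {k : Type*} [Field k] {r : k} (hr : aeval r F = 0) (hc : ((F.content : ℤ) : k) ≠ 0)
    (hNk : (N : k) ≠ 0) :
    ∃ φ : 𝓞 K →+* k, ∀ (x : 𝓞 K) (h : ℤ[X]), aeval θ h = N * (x : K) →
      N * φ x = aeval r h := by
  have hz : ∀ f g : ℤ[X], aeval θ f = aeval θ g → aeval r f = aeval r g := by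
    intro f g h
    rw [← sub_eq_zero, ← map_sub] at h ⊢
    exact aeval_eq_zero_of_aeval_eq_zero hF hθ h hr hc
  choose h hh using hN
  refine ⟨{ toFun := fun x ↦ (N : k)⁻¹ * aeval r (h x)
            map_one' := ?_
            map_mul' := fun x y ↦ ?_
            map_zero' := ?_
            map_add' := fun x y ↦ ?_ }, fun x f hf ↦ ?_⟩
  · have := hz (h 1) (C N) (by rw [hh, aeval_C]; simp)
    rw [this, aeval_C]
    simp [hNk]
  · have := hz (C N * h (x * y)) (h x * h y) (by
      rw [map_mul, map_mul, aeval_C, hh, hh, hh]; simp; ring)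
    rw [map_mul, map_mul, aeval_C] at this
    replace this : (N : k) * aeval r (h (x * y)) = aeval r (h x) * aeval r (h y) := by
      simpa using this
    field_simp
    linear_combination this
  · have := hz (h 0) 0 (by rw [hh]; simp)
    rw [this]; simp
  · have := hz (h (x + y)) (h x + h y) (by rw [map_add, hh, hh, hh]; simp; ring)
    rw [this, map_add, mul_add]
  · change (N : k) * ((N : k)⁻¹ * aeval r (h x)) = _
    rw [mul_inv_cancel_left₀ hNk]
    exact hz _ _ ((hh x).trans hf.symm)

theorem aeval_intCast_mul_scaleRoots {R : Type*} [CommRing R] (N : ℤ) (r : R) (f : ℤ[X]) :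
    aeval ((N : R) * r) (scaleRoots f N) = (N : R) ^ f.natDegree * aeval r f := by
  simpa [aeval_def] using scaleRoots_eval₂_mul (p := f) (algebraMap ℤ R) r N

/-- The bijection sends `φ` to `N⁻¹ * φ α`, which plays the role of `φ θ`. `scaleRoots` turns
relations in `θ` into relations in the integral element `α`. -/
theorem card_ringHom_eq_card_roots {F : ℤ[X]} (hF : Irreducible (F.map (Int.castRingHom ℚ)))
    (hθ : aeval θ F = 0) {N : ℤ} {α : 𝓞 K} (hα : (α : K) = N * θ)
    (hN : ∀ x : 𝓞 K, ∃ h : ℤ[X], aeval θ h = N * (x : K))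
    {k : Type*} [Field k] (hc : ((F.content : ℤ) : k) ≠ 0) (hNk : (N : k) ≠ 0) :
    Nat.card (𝓞 K →+* k) = Nat.card {r : k // aeval r F = 0} := by
  have hcoe : ∀ f : ℤ[X], ((aeval α f : 𝓞 K) : K) = aeval (α : K) f := fun f ↦
    (aeval_algebraMap_apply K α f).symm
  have hmap : ∀ (φ : 𝓞 K →+* k) (f : ℤ[X]), φ (aeval α f) = aeval (φ α) f := by
    intro φ f
    rw [aeval_def, aeval_def, hom_eval₂]
    congr 1
    exact RingHom.ext_int _ _
  have hroot : ∀ φ : 𝓞 K →+* k, aeval ((N : k)⁻¹ * φ α) F = 0 := by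
    intro φ
    have h1 : aeval α (scaleRoots F N) = (0 : 𝓞 K) := by
      apply RingOfIntegers.ext
      rw [hcoe, hα, aeval_intCast_mul_scaleRoots, hθ]; simp
    have h2 := aeval_intCast_mul_scaleRoots N ((N : k)⁻¹ * φ α) F
    rw [mul_inv_cancel_left₀ hNk, ← hmap, h1, map_zero, eq_comm] at h2
    exact (mul_eq_zero.mp h2).resolve_left (pow_ne_zero _ hNk)
  refine Nat.card_congr (Equiv.ofBijective (fun φ ↦ ⟨(N : k)⁻¹ * φ α, hroot φ⟩) ⟨?_, ?_⟩)
  · intro φ ψ h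
    have h1 : φ α = ψ α :=
      mul_left_cancel₀ (inv_ne_zero hNk) (congrArg (fun z : {r : k // aeval r F = 0} ↦ z.1) h)
    ext x
    obtain ⟨f, hf⟩ := hN x
    have h2 : aeval α (scaleRoots f N) = (N : 𝓞 K) ^ (f.natDegree + 1) * x := by
      apply RingOfIntegers.ext
      rw [hcoe, hα, aeval_intCast_mul_scaleRoots, hf]; simp; ring
    have h3 := hmap φ (scaleRoots f N)
    rw [h1, ← hmap ψ, h2] at h3
    simp only [map_mul, map_pow, map_intCast] at h3
    exact mul_left_cancel₀ (pow_ne_zero _ hNk) h3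
  · rintro ⟨r, hr⟩
    obtain ⟨φ, hφ⟩ := exists_ringHom_of_aeval_eq_zero hF hθ hN hr hc hNk
    refine ⟨φ, Subtype.ext ?_⟩
    -- The polynomial `N ^ 2 * X` represents `N * α = N ^ 2 * θ`.
    have := hφ α (C (N ^ 2) * X) (by rw [map_mul, aeval_C, aeval_X, hα]; simp; ring)
    rw [map_mul, aeval_C, aeval_X] at this
    replace this : (N : k) * φ α = (N : k) ^ 2 * r := by simpa using this
    change (N : k)⁻¹ * φ α = r
    field_simp
    apply mul_left_cancel₀ hNk
    rw [this]; ring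

theorem exists_finite_polyRho_eq_card_ideal {F : ℤ[X]}
    (hF : Irreducible (F.map (Int.castRingHom ℚ)))
    (hθ : aeval θ F = 0) (hK : IntermediateField.adjoin ℚ {θ} = ⊤) :
    ∃ M : ℤ, M ≠ 0 ∧ ∀ p : ℕ, p.Prime → ¬ (p : ℤ) ∣ M →
      polyRho F p = Nat.card {I : Ideal (𝓞 K) // Ideal.absNorm I = p} := by
  obtain ⟨N, hN0, ⟨α, hα⟩, hN⟩ := exists_common_denominator hK
  have hF0 : F ≠ 0 := by rintro rfl; simp at hF
  refine ⟨F.content * N, mul_ne_zero (content_eq_zero_iff.not.mpr hF0) hN0, fun p hp hpM ↦ ?_⟩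
  have := Fact.mk hp
  rw [Ideal.card_absNorm_eq_prime hp, polyRho_eq_card F hp.ne_zero,
    card_ringHom_eq_card_roots hF hθ hα hN]
  · rw [Ne, ZMod.intCast_zmod_eq_zero_iff_dvd]
    exact fun h ↦ hpM (h.mul_right _)
  · rw [Ne, ZMod.intCast_zmod_eq_zero_iff_dvd]
    exact fun h ↦ hpM (h.mul_left _)

end

/-! ### The quotient series and the continuation of the zeta function. -/

section

open Polynomial NumberField Filter Asymptotics Topology

theorem ArithmeticFunction.mul_apply_prime_pow {R : Type*} [Semiring R]
    (f h : ArithmeticFunction R) {p : ℕ} (hp : p.Prime) (k : ℕ) :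
    (f * h) (p ^ k) = ∑ i ∈ Finset.range (k + 1), f (p ^ i) * h (p ^ (k - i)) := by
  rw [mul_apply, Nat.sum_divisorsAntidiagonal (f := fun d e ↦ f d * h e),
    Nat.sum_divisors_prime_pow hp]
  refine Finset.sum_congr rfl fun i hi ↦ ?_
  rw [Nat.pow_div (Finset.mem_range_succ_iff.mp hi) hp.pos]

/-- `polyRho F` as an arithmetic function. -/
noncomputable def polyRhoFunction (F : ℤ[X]) : ArithmeticFunction ℂ :=
  ⟨fun n ↦ polyRho F n, by simp [polyRho_zero]⟩

theorem polyRhoFunction_apply (F : ℤ[X]) (n : ℕ) : polyRhoFunction F n = polyRho F n := rfl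

theorem isMultiplicative_polyRhoFunction (F : ℤ[X]) : (polyRhoFunction F).IsMultiplicative :=
  ⟨by simp [polyRhoFunction_apply, polyRho_one], fun h ↦ by
    simp [polyRhoFunction_apply, polyRho_mul_of_coprime F h]⟩

/-- The Dirichlet convolution quotient of `polyRho F` by the ideal counting function of `K`. -/
noncomputable def polyRhoQuotient (F : ℤ[X]) (K : Type*) [Field K] [NumberField K] :
    ArithmeticFunction ℂ :=
  polyRhoFunction F * idealMoebius K

section

variable {F : ℤ[X]} (K : Type*) [Field K] [NumberField K]

theorem polyRhoQuotient_mul_idealCount :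
    polyRhoQuotient F K * idealCount K = polyRhoFunction F := by
  rw [polyRhoQuotient, mul_assoc, idealMoebius_mul_idealCount, mul_one]

theorem isMultiplicative_polyRhoQuotient : (polyRhoQuotient F K).IsMultiplicative :=
  (isMultiplicative_polyRhoFunction F).mul isMultiplicative_idealMoebius

theorem norm_polyRhoQuotient_prime_pow_le {p : ℕ} (hp : p.Prime) {B : ℝ}
    (hB : ∀ k, (polyRho F (p ^ k) : ℝ) ≤ B) (k : ℕ) :
    ‖polyRhoQuotient F K (p ^ k)‖ ≤ B * 2 ^ Module.finrank ℚ K * (k + 1) := by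
  have hB0 : 0 ≤ B := (Nat.cast_nonneg _).trans (hB 0)
  rw [polyRhoQuotient, ArithmeticFunction.mul_apply_prime_pow _ _ hp]
  refine (norm_sum_le _ _).trans ((Finset.sum_le_card_nsmul _ _
    (B * 2 ^ Module.finrank ℚ K) fun i _ ↦ ?_).trans (le_of_eq ?_))
  · rw [norm_mul, polyRhoFunction_apply, Complex.norm_natCast]
    exact mul_le_mul (hB i) (norm_idealMoebius_apply_pow_le hp _) (norm_nonneg _) hB0
  · rw [Finset.card_range, nsmul_eq_mul]; push_cast; ring

theorem exists_norm_polyRhoQuotient_prime_pow_le (hF : Irreducible (F.map (Int.castRingHom ℚ)))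
    {p : ℕ} (hp : p.Prime) : ∃ C : ℝ, ∀ k : ℕ, ‖polyRhoQuotient F K (p ^ k)‖ ≤ C * (k + 1) := by
  obtain ⟨U, V, D, hD0, hD⟩ := exists_mul_add_mul_derivative_eq_C hF
  obtain ⟨B, hB⟩ := exists_polyRho_prime_pow_le hD hD0 hp
  exact ⟨_, norm_polyRhoQuotient_prime_pow_le K hp (B := B) fun k ↦ by exact_mod_cast hB k⟩

theorem exists_finite_polyRhoQuotient (hF : Irreducible (F.map (Int.castRingHom ℚ))) {θ : K}
    (hθ : aeval θ F = 0) (hK : IntermediateField.adjoin ℚ {θ} = ⊤) :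
    ∃ (S : Set ℕ) (C : ℝ), S.Finite ∧
      (∀ p, p.Prime → p ∉ S → ∀ k : ℕ, ‖polyRhoQuotient F K (p ^ k)‖ ≤ C * (k + 1)) ∧
      ∀ p, p.Prime → p ∉ S → polyRhoQuotient F K p = 0 := by
  obtain ⟨U, V, D, hD0, hD⟩ := exists_mul_add_mul_derivative_eq_C hF
  obtain ⟨M, hM0, hM⟩ := exists_finite_polyRho_eq_card_ideal hF hθ hK
  have hsub : ∀ p : ℕ, p ∉ {p : ℕ | p ∣ (D * M).natAbs} → ¬ (p : ℤ) ∣ D ∧ ¬ (p : ℤ) ∣ M := by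
    intro p hp
    have hp' : ¬ (p : ℤ) ∣ D * M := fun h ↦ hp (Int.natCast_dvd.mp h)
    exact ⟨fun h ↦ hp' (h.mul_right _), fun h ↦ hp' (h.mul_left _)⟩
  refine ⟨{p : ℕ | p ∣ (D * M).natAbs}, _, ?_, fun p hp hpS ↦
    norm_polyRhoQuotient_prime_pow_le K hp (B := F.natDegree + 1) fun k ↦ ?_, fun p hp hpS ↦ ?_⟩
  · have h0 : (D * M).natAbs ≠ 0 := Int.natAbs_ne_zero.mpr (mul_ne_zero hD0 hM0)
    refine (Finset.finite_toSet (D * M).natAbs.divisors).subset fun p hp ↦ ?_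
    exact Finset.mem_coe.mpr (Nat.mem_divisors.mpr ⟨hp, h0⟩)
  · exact_mod_cast polyRho_prime_pow_le_natDegree hD hp (hsub p hpS).1 k
  -- At a prime the convolution is `polyRho F p` minus the number of ideals of norm `p`.
  · have h := ArithmeticFunction.mul_apply_prime_pow (polyRhoFunction F) (idealMoebius K) hp 1
    rw [Finset.sum_range_succ, Finset.sum_range_one] at h
    simp only [pow_one, pow_zero, Nat.sub_zero, Nat.sub_self,
      isMultiplicative_idealMoebius.1, (isMultiplicative_polyRhoFunction F).1] at h
    rw [polyRhoQuotient, h, idealMoebius_apply_prime hp, polyRhoFunction_apply,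
      hM p hp (hsub p hpS).2]
    simp [idealCount, hp.ne_zero]

theorem LSeriesSummable_polyRhoQuotient (hF : Irreducible (F.map (Int.castRingHom ℚ))) {θ : K}
    (hθ : aeval θ F = 0) (hK : IntermediateField.adjoin ℚ {θ} = ⊤) {σ : ℝ} (hσ : 1 / 2 < σ) :
    LSeriesSummable (polyRhoQuotient F K) σ := by
  obtain ⟨S, C, hS, hC, h0⟩ := exists_finite_polyRhoQuotient K hF hθ hK
  exact ArithmeticFunction.LSeriesSummable_of_prime_pow (isMultiplicative_polyRhoQuotient K) hS hC
    (fun p hp ↦ exists_norm_polyRhoQuotient_prime_pow_le K hF hp) h0 hσ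

/-- The local factor is a Cauchy product of a series with nonnegative terms and first term `1`, and
of the nonzero local factor of `1 / ζ`. -/
theorem tsum_polyRhoQuotient_prime_pow_ne_zero (hF : Irreducible (F.map (Int.castRingHom ℚ)))
    {p : ℕ} (hp : p.Prime) :
    ∑' k, LSeries.term (polyRhoQuotient F K) (1 : ℝ) (p ^ k) ≠ 0 := by
  obtain ⟨U, V, D, hD0, hD⟩ := exists_mul_add_mul_derivative_eq_C hF
  obtain ⟨B, hB⟩ := exists_polyRho_prime_pow_le hD hD0 hp
  set x : ℝ := (p : ℝ)⁻¹ with hx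
  have hx0 : 0 ≤ x := by positivity
  have hx1 : x < 1 := inv_lt_one_of_one_lt₀ (by exact_mod_cast hp.one_lt)
  have hnx : ‖(x : ℂ)‖ = x := by rw [Complex.norm_real, Real.norm_of_nonneg hx0]
  have hterm : ∀ k, LSeries.term (polyRhoQuotient F K) (1 : ℝ) (p ^ k) =
      ∑ i ∈ Finset.range (k + 1), (polyRho F (p ^ i) * (x : ℂ) ^ i) *
        (idealMoebius K (p ^ (k - i)) * (x : ℂ) ^ (k - i)) := by
    intro k
    rw [LSeries.term_of_ne_zero (pow_ne_zero _ hp.ne_zero), Complex.ofReal_one, Complex.cpow_one,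
      polyRhoQuotient, ArithmeticFunction.mul_apply_prime_pow _ _ hp, Finset.sum_div]
    refine Finset.sum_congr rfl fun i hi ↦ ?_
    have : (x : ℂ) ^ k = (x : ℂ) ^ i * (x : ℂ) ^ (k - i) := by
      rw [← pow_add, Nat.add_sub_cancel' (Finset.mem_range_succ_iff.mp hi)]
    rw [polyRhoFunction_apply, mul_mul_mul_comm, ← this, hx]
    push_cast
    rw [inv_pow, div_eq_mul_inv]
  have hgeo : Summable fun k : ℕ ↦ x ^ k := summable_geometric_of_lt_one hx0 hx1
  have hs1 : Summable fun k ↦ ‖(polyRho F (p ^ k) : ℂ) * (x : ℂ) ^ k‖ := by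
    refine Summable.of_nonneg_of_le (fun _ ↦ norm_nonneg _) (fun k ↦ ?_) (hgeo.mul_left (B : ℝ))
    rw [norm_mul, norm_pow, hnx, Complex.norm_natCast]
    gcongr
    exact_mod_cast hB k
  have hs2 : Summable fun k ↦ ‖idealMoebius K (p ^ k) * (x : ℂ) ^ k‖ := by
    refine Summable.of_nonneg_of_le (fun _ ↦ norm_nonneg _) (fun k ↦ ?_)
      (hgeo.mul_left (2 ^ Module.finrank ℚ K))
    rw [norm_mul, norm_pow, hnx]
    gcongr
    exact norm_idealMoebius_apply_pow_le hp k
  simp_rw [hterm]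
  rw [← tsum_mul_tsum_eq_tsum_sum_range_of_summable_norm hs1 hs2]
  obtain ⟨L, hL0, hL⟩ := exists_hasSum_idealMoebius_apply_pow (K := K) hp (x := x)
    (by rw [hnx]; exact hx1)
  rw [hL.tsum_eq]
  refine mul_ne_zero (fun h ↦ ?_) hL0
  have hcast : ∀ k, (polyRho F (p ^ k) : ℂ) * (x : ℂ) ^ k =
      ((polyRho F (p ^ k) * x ^ k : ℝ) : ℂ) := fun k ↦ by push_cast; rfl
  simp_rw [hcast] at h hs1
  rw [← Complex.ofReal_tsum, Complex.ofReal_eq_zero] at h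
  simp_rw [Complex.norm_real] at hs1
  have h1 := hs1.of_norm.le_tsum 0 (fun _ _ ↦ by positivity)
  rw [h, pow_zero, polyRho_one] at h1
  norm_num at h1

theorem LSeries_polyRhoQuotient_one_ne_zero (hF : Irreducible (F.map (Int.castRingHom ℚ))) {θ : K}
    (hθ : aeval θ F = 0) (hK : IntermediateField.adjoin ℚ {θ} = ⊤) :
    LSeries (polyRhoQuotient F K) 1 ≠ 0 := by
  obtain ⟨S, C, hS, hC, h0⟩ := exists_finite_polyRhoQuotient K hF hθ hK
  have := ArithmeticFunction.LSeries_ne_zero_of_prime_pow (isMultiplicative_polyRhoQuotient K) hS hC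
    (fun p hp ↦ exists_norm_polyRhoQuotient_prime_pow_le K hF hp) h0 (σ := 1) (by norm_num)
    (fun p hp ↦ tsum_polyRhoQuotient_prime_pow_ne_zero K hF hp)
  simpa using this

namespace NumberField

theorem dedekindZeta_eq_LSeries_idealCount (s : ℂ) : dedekindZeta K s = LSeries (idealCount K) s :=
  LSeries_congr (fun {n} hn ↦ by simp [idealCount, hn]) s

theorem exists_sum_idealCount_sub_le : ∃ B r : ℝ, 1 / 2 < r ∧ r < 1 ∧ ∀ X : ℝ, 1 ≤ X →
    ‖(∑ k ∈ Finset.Icc 1 ⌊X⌋₊, idealCount K k) - (dedekindZeta_residue K : ℂ) * X‖ ≤ B * X ^ r := by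
  obtain ⟨B, hB⟩ := NumberField.Ideal.exists_sum_card_norm_sub_le K
  have hd : (1 : ℝ) ≤ Module.finrank ℚ K := by exact_mod_cast Module.finrank_pos
  set d : ℝ := ((Module.finrank ℚ K : ℕ) : ℝ) with hd'
  have h4 : 1 / (4 * d) ≤ 1 / 4 := one_div_le_one_div_of_le (by norm_num) (by linarith)
  have h5 : 0 < 1 / (4 * d) := by positivity
  -- The exponent `1 - 1 / (2d)` is weakened because for `d = 1` it equals `1 / 2`, where the series
  -- of `g` need not converge.
  refine ⟨|B|, 1 - 1 / (4 * d), by linarith, by linarith, fun X hX ↦ ?_⟩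
  have h1 : (∑ k ∈ Finset.Icc 1 ⌊X⌋₊, idealCount K k) - (dedekindZeta_residue K : ℂ) * X =
      (((∑ k ∈ Finset.Icc 1 ⌊X⌋₊, (Nat.card {I : Ideal (𝓞 K) // Ideal.absNorm I = k} : ℝ)) -
        dedekindZeta_residue K * X : ℝ) : ℂ) := by
    push_cast
    congr 1
    refine Finset.sum_congr rfl fun k hk ↦ ?_
    have : k ≠ 0 := Nat.one_le_iff_ne_zero.mp (Finset.mem_Icc.mp hk).1
    simp [idealCount, this]
  rw [h1, Complex.norm_real, Real.norm_eq_abs]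
  refine (hB X hX).trans ?_
  have h2 : X ^ (1 - 1 / (2 * d)) ≤ X ^ (1 - 1 / (4 * d)) := by
    refine Real.rpow_le_rpow_of_exponent_le hX (sub_le_sub_left ?_ _)
    exact one_div_le_one_div_of_le (by linarith) (by linarith)
  exact mul_le_mul (le_abs_self B) h2 (by positivity) (abs_nonneg B)

theorem LSeriesSummable_idealCount {s : ℂ} (hs : 1 < s.re) : LSeriesSummable (idealCount K) s := by
  obtain ⟨B, r, -, hr1, hB⟩ := exists_sum_idealCount_sub_le K
  set κ : ℂ := ((dedekindZeta_residue K : ℝ) : ℂ)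
  have hcast : ∀ n, ((‖idealCount K n‖ : ℝ) : ℂ) = idealCount K n := by
    intro n
    rcases eq_or_ne n 0 with rfl | hn
    · simp
    · simp [idealCount, hn]
  have := LSeriesSummable_of_sum_norm_bigO_and_nonneg (f := fun n ↦ ‖idealCount K n‖) (r := 1)
    (s := s) ?_ (fun _ ↦ norm_nonneg _) zero_le_one hs
  · simpa only [hcast] using this
  · refine IsBigO.of_bound (|B| + ‖κ‖) ?_
    filter_upwards [eventually_ge_atTop 1] with n hn
    have hn' : (1 : ℝ) ≤ n := by exact_mod_cast hn
    have h1 := hB n hn'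
    rw [Nat.floor_natCast] at h1
    have h2 := norm_add_le ((∑ k ∈ Finset.Icc 1 n, idealCount K k) - κ * (n : ℝ)) (κ * (n : ℝ))
    rw [sub_add_cancel, norm_mul, Complex.norm_real (n : ℝ),
      Real.norm_of_nonneg (Nat.cast_nonneg n)] at h2
    have h3 : B * (n : ℝ) ^ r ≤ |B| * n := by
      refine mul_le_mul (le_abs_self B) ?_ (by positivity) (abs_nonneg B)
      simpa using Real.rpow_le_rpow_of_exponent_le hn' hr1.le
    rw [Real.rpow_one, Real.norm_of_nonneg (Nat.cast_nonneg n), ← Complex.norm_real]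
    push_cast
    simp_rw [hcast]
    linarith

theorem exists_dedekindZeta_continuation : ∃ (r : ℝ) (H : ℂ → ℂ), 1 / 2 < r ∧ r < 1 ∧
    DifferentiableOn ℂ H {s | r < s.re} ∧ ∀ s : ℂ, 1 < s.re →
      dedekindZeta K s = dedekindZeta_residue K * s / (s - 1) + s * H s := by
  obtain ⟨B, r, hr, hr1, hB⟩ := exists_sum_idealCount_sub_le K
  obtain ⟨H, hH, h⟩ := LSeries.exists_continuation_of_sum_sub_le (by linarith) hr1
    (fun s hs ↦ LSeriesSummable_idealCount K hs) hB
  exact ⟨r, H, hr, hr1, hH, fun s hs ↦ by rw [dedekindZeta_eq_LSeries_idealCount, h s hs]⟩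

end NumberField

end

theorem isOpen_setOf_lt_re (η : ℝ) : IsOpen {s : ℂ | η < s.re} :=
  isOpen_lt continuous_const Complex.continuous_re

/-- Real points to the right of `1` accumulate at `1`, so the local identity principle applies. Any
two continuations can thus be compared near the pole without a global uniqueness argument. -/
theorem MeromorphicAt.eventuallyEq_of_forall_one_lt_re {f g : ℂ → ℂ} (hf : MeromorphicAt f 1)
    (hg : MeromorphicAt g 1) (h : ∀ s : ℂ, 1 < s.re → f s = g s) : f =ᶠ[𝓝[≠] 1] g := by
  refine (hf.frequently_eq_iff_eventuallyEq hg).mp ?_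
  have ht : Tendsto (fun x : ℝ ↦ (x : ℂ)) (𝓝[>] 1) (𝓝[≠] 1) := by
    refine tendsto_nhdsWithin_iff.mpr ⟨?_, ?_⟩
    · simpa using (Complex.continuous_ofReal.tendsto 1).mono_left nhdsWithin_le_nhds
    · filter_upwards [self_mem_nhdsWithin] with x hx
      have : (x : ℝ) ≠ 1 := (Set.mem_Ioi.mp hx).ne'
      rw [Set.mem_compl_iff, Set.mem_singleton_iff]
      exact_mod_cast this
  refine ht.frequently (Eventually.frequently ?_)
  filter_upwards [self_mem_nhdsWithin] with x hx
  exact h x (by simpa using hx)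

end

/-! ### The main theorem. -/

theorem mainTheorem6 (F : Polynomial ℤ)
    (hF : Irreducible (F.map (Int.castRingHom ℚ)))
    (K : Type*) [Field K] [NumberField K] (θ : K)
    (hθ : Polynomial.aeval θ F = 0)
    (hK : IntermediateField.adjoin ℚ {θ} = ⊤) :
    ∃ Ψ : ℂ → ℂ,
      DifferentiableOn ℂ Ψ {s : ℂ | 1 / 2 < s.re} ∧
      (∀ ε : ℝ, 0 < ε → ∃ C : ℝ, ∀ s : ℂ, 1 / 2 + ε < s.re → ‖Ψ s‖ ≤ C) ∧
      -- absolute convergence and factorisation of the Dirichlet series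
      (∀ s : ℂ, 1 < s.re →
        LSeriesSummable (fun n : ℕ => (polyRho F n : ℂ)) s ∧
        polyRhoSeries F s = NumberField.dedekindZeta K s * Ψ s) ∧
      -- the zeta function extends beyond `Re s = 1`
      (∃ η : ℝ, 1 / 2 ≤ η ∧ η < 1 ∧
        ∃ Z : ℂ → ℂ, IsMeromorphicContinuation (NumberField.dedekindZeta K) Z η) ∧
      -- the factorisation persists wherever the zeta function is continued in `Re s > 1 / 2`,
      -- the Dirichlet series has a simple pole at `1`, and the residue of zeta is as named
      (∀ η : ℝ, 1 / 2 ≤ η → η < 1 → ∀ Z : ℂ → ℂ,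
        IsMeromorphicContinuation (NumberField.dedekindZeta K) Z η →
          IsMeromorphicContinuation (polyRhoSeries F) (fun s => Z s * Ψ s) η ∧
          meromorphicOrderAt (fun s => Z s * Ψ s) 1 = -1 ∧
          Filter.Tendsto (fun s : ℂ => (s - 1) * Z s) (nhdsWithin 1 {1}ᶜ)
            (nhds (NumberField.dedekindZeta_residue K : ℂ))) ∧
      -- the mean value with a power saving
      ∃ lam : ℝ, 0 < lam ∧ lam < 1 ∧ ∃ C : ℝ, ∀ X : ℝ, 1 ≤ X →
        ‖(∑ n ∈ Finset.Icc 1 ⌊X⌋₊, (polyRho F n : ℂ)) -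
            (Ψ 1 * (NumberField.dedekindZeta_residue K : ℂ)) * (X : ℂ)‖ ≤ C * X ^ lam := by
  have hsum : ∀ σ : ℝ, 1 / 2 < σ → LSeriesSummable (polyRhoQuotient F K) σ :=
    fun σ hσ ↦ LSeriesSummable_polyRhoQuotient K hF hθ hK hσ
  have hdiff : DifferentiableOn ℂ (LSeries (polyRhoQuotient F K)) {s : ℂ | 1 / 2 < s.re} := by
    refine (LSeries_differentiableOn _).mono fun s hs ↦ ?_
    refine lt_of_le_of_lt (LSeries.abscissaOfAbsConv_le_of_forall_lt_LSeriesSummable hsum) ?_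
    exact EReal.coe_lt_coe_iff.mpr hs
  have hfac : ∀ s : ℂ, 1 < s.re → LSeriesSummable (fun n : ℕ => (polyRho F n : ℂ)) s ∧
      polyRhoSeries F s = NumberField.dedekindZeta K s * LSeries (polyRhoQuotient F K) s := by
    intro s hs
    have h1 : LSeriesSummable (polyRhoQuotient F K) s :=
      (hsum s.re (by linarith)).of_re_le_re (by simp)
    have h2 := NumberField.LSeriesSummable_idealCount K hs
    have h3 := ArithmeticFunction.LSeriesSummable_mul h1 h2
    have h4 := ArithmeticFunction.LSeries_mul' h1 h2
    rw [polyRhoQuotient_mul_idealCount] at h3 h4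
    exact ⟨h3, h4.trans (by rw [NumberField.dedekindZeta_eq_LSeries_idealCount, mul_comm])⟩
  refine ⟨LSeries (polyRhoQuotient F K), hdiff, fun ε hε ↦ ?_, hfac, ?_, fun η hη hη1 Z hZ ↦ ?_, ?_⟩
  · have hs := (hsum (1 / 2 + ε) (by linarith)).norm
    refine ⟨_, fun s hs' ↦ tsum_of_norm_bounded hs.hasSum fun n ↦ ?_⟩
    exact LSeries.norm_term_le_of_re_le_re _ (by simpa using hs'.le) n
  · obtain ⟨r, H, hr, hr1, hH, h⟩ := NumberField.exists_dedekindZeta_continuation K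
    refine ⟨r, hr.le, hr1, fun s ↦ NumberField.dedekindZeta_residue K * s / (s - 1) + s * H s,
      fun s hs ↦ ?_, fun s hs ↦ (h s hs).symm⟩
    have : MeromorphicAt H s :=
      (hH.analyticAt ((isOpen_setOf_lt_re r).mem_nhds hs)).meromorphicAt
    fun_prop
  · obtain ⟨r, H, hr, hr1, hH, h⟩ := NumberField.exists_dedekindZeta_continuation K
    set κ : ℂ := ((NumberField.dedekindZeta_residue K : ℝ) : ℂ) with hκ
    have hH1 : AnalyticAt ℂ H 1 :=
      hH.analyticAt ((isOpen_setOf_lt_re r).mem_nhds (by simpa using hr1))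
    have hΨ : ∀ s : ℂ, 1 / 2 < s.re → AnalyticAt ℂ (LSeries (polyRhoQuotient F K)) s :=
      fun s hs ↦ hdiff.analyticAt ((isOpen_setOf_lt_re _).mem_nhds hs)
    have hΨ1 := hΨ 1 (by norm_num)
    have hZΨ : MeromorphicOn (fun s ↦ Z s * LSeries (polyRhoQuotient F K) s) {s : ℂ | η < s.re} :=
      fun s hs ↦ (hZ.1 s hs).mul (hΨ s (lt_of_le_of_lt hη hs)).meromorphicAt
    have h1mem : (1 : ℂ) ∈ {s : ℂ | η < s.re} := by simpa using hη1
    -- An arbitrary continuation `Z` inherits the explicit principal part near `1`, which yields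
    -- both the residue and, as `Ψ 1 ≠ 0`, the order `-1` of the product.
    have heq : Z =ᶠ[nhdsWithin 1 {1}ᶜ] fun s ↦ κ * s / (s - 1) + s * H s := by
      refine (hZ.1 1 h1mem).eventuallyEq_of_forall_one_lt_re ?_
        fun s hs ↦ (hZ.2 s hs).trans (h s hs)
      have := hH1.meromorphicAt
      fun_prop
    have heq' : ∀ᶠ s in nhdsWithin (1 : ℂ) {1}ᶜ, s - 1 ≠ 0 ∧
        Z s = (s - 1)⁻¹ * (κ * s + (s - 1) * (s * H s)) := by
      filter_upwards [heq, self_mem_nhdsWithin] with s hs hs1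
      have : s - 1 ≠ 0 := sub_ne_zero.mpr hs1
      refine ⟨this, ?_⟩
      rw [hs]
      field_simp
    refine ⟨⟨hZΨ, fun s hs ↦ ?_⟩, ?_, ?_⟩
    · simp only [hZ.2 s hs, (hfac s hs).2]
    · refine (meromorphicOrderAt_eq_int_iff (n := -1) (hZΨ 1 h1mem)).mpr
        ⟨fun s ↦ (κ * s + (s - 1) * (s * H s)) * LSeries (polyRhoQuotient F K) s, ?_, ?_, ?_⟩
      · fun_prop
      · simp only [sub_self, zero_mul, add_zero, mul_one]
        refine mul_ne_zero ?_ (LSeries_polyRhoQuotient_one_ne_zero K hF hθ hK)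
        exact Complex.ofReal_ne_zero.mpr (NumberField.dedekindZeta_residue_ne_zero K)
      · filter_upwards [heq'] with s hs
        rw [hs.2, zpow_neg_one, smul_eq_mul, mul_assoc]
    · have hcont : Filter.Tendsto (fun s : ℂ ↦ κ * s + (s - 1) * (s * H s)) (nhdsWithin 1 {1}ᶜ)
          (nhds κ) := by
        have : ContinuousAt (fun s : ℂ ↦ κ * s + (s - 1) * (s * H s)) 1 := by
          have := hH1.continuousAt
          fun_prop
        simpa using this.tendsto.mono_left nhdsWithin_le_nhds
      refine hcont.congr' ?_
      filter_upwards [heq'] with s hs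
      rw [hs.2, mul_inv_cancel_left₀ hs.1]
  · obtain ⟨B, r, hr, hr1, hB⟩ := NumberField.exists_sum_idealCount_sub_le K
    -- The exponent of the ideal count survives the convolution because `r > 1/2` lies in the range
    -- of absolute convergence of `Ψ`.
    obtain ⟨C, hC⟩ := ArithmeticFunction.exists_sum_mul_sub_le hr1 (hsum r hr) hB
    rw [polyRhoQuotient_mul_idealCount] at hC
    exact ⟨r, by linarith, hr1, C, hC⟩
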